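/- **Theorem (Craig curve, $\operatorname{rank}_3\ge 4$).** For an integer $m>1$ and an abelian group $M$ let $\operatorname{rank}_m M$ be the largest $r$ such that $(\mathbb Z/m\mathbb Z)^r$ embeds in $M$. Define polynomials in $\mathbb Q[t]$ by $$\begin{aligned} A&=3t^3-1,\qquad B=9t^4+9t^3+9t^2+3t+1,\qquad C_0=81t^7-81t^6+18t^3-9t^2+3t-1,\\ D_0&=81t^8-54t^5-9t^4+9t^2+3t+2,\qquad E=81t^8+81t^7-27t^5-45t^4-9t^3+3t+1,\\ F&=81t^{10}+81t^9+81t^8-27t^7-45t^6-63t^5-9t^4+3t^3+10t^2+3t+2,\\ G&=729t^{12}-486t^9+81t^7+81t^6-27t^4-9t^3+3t+1,\\ H&=6561t^{16}+13122t^{15}+19683t^{14}+13122t^{13}+3645t^{12}-8019t^{11}-9477t^{10}-7047t^9-1701t^8\\&\quad+567t^7+1215t^6+675t^5+288t^4+72t^3+18t^2+3t+1,\\ I&=4782969t^{28}+9565938t^{27}+9565938t^{26}-12754584t^{24}-16474671t^{23}-10628820t^{22}+1948617t^{21}\\&\quad+8562105t^{20}+9506889t^{19}+4192479t^{18}-98415t^{17}-2768742t^{16}-2322594t^{15}-1226907t^{14}\\&\quad-48114t^{13}+325863t^{12}+334611t^{11}+148716t^{10}+37179t^9-13284t^8-14904t^7-8748t^6-3024t^5\\&\quad-864t^4-153t^3-27t^2-3t-1,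 \end{aligned}$$ and put $$\begin{aligned} x_0&=9t^2A^2D_0E,& y_0&=9t^2FG,& z_0&=C_0H,\\ x_1&=3tAD_0H/B,& y_1&=I/B,& z_1&=3tABC_0E,\\ x_2&=-27t^3AD_0F,& y_2&=-3tAEG, \end{aligned}$$ $$\begin{aligned} z_2&=-531441t^{23}-531441t^{22}+885735t^{20}+1062882t^{19}+177147t^{18}-551124t^{17}-800442t^{16}-255879t^{15}\\&\quad+131220t^{14}+284310t^{13}+134865t^{12}+8019t^{11}-44469t^{10}-30375t^9-8748t^8+810t^7+2349t^6\\&\quad+1026t^5+342t^4+36t^3+18t^2+1. \end{aligned}$$ Let $f(x,y,z)=x^6+y^6+z^6-2x^3y^3-2x^3z^3-2y^3z^3$ and $h(t)=f(x_0,y_0,z_0)\in\mathbb Q[t]$. Then: 1. $x_1z_1=x_0z_0$, $x_2y_2=x_0y_0$, $x_1^3-y_1^3+z_1^3=-(x_0^3-y_0^3+z_0^3)$ and $x_2^3+y_2^3-z_2^3=-(x_0^3+y_0^3-z_0^3)$ (so that $f(x_0,y_0,z_0)=f(x_1,y_1,z_1)=f(x_2,y_2,z_2)$); 2. $h$ has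 degree $141$. Let $C$ be the nonsingular projective model over $\mathbb Q$ of the hyperelliptic curve $Y^2=h(t)$ (it has a rational point at infinity, so $\operatorname{Jac}(C)(\mathbb Q)$ is the group of degree-zero divisors on $C$ over $\mathbb Q$ modulo principal divisors). Then: 3. there are divisors $D_1,\dots,D_4$ of degree $0$ on $C$ with $$\begin{aligned} \operatorname{div}(Y+x_0^3+y_0^3-z_0^3)&=3D_1,&\operatorname{div}(Y+x_0^3-y_0^3+z_0^3)&=3D_2,\\ \operatorname{div}(Y+x_1^3+y_1^3-z_1^3)&=3D_3,&\operatorname{div}(Y-x_2^3+y_2^3+z_2^3)&=3D_4, \end{aligned}$$ whose classes in $\operatorname{Jac}(C)(\mathbb Q)$ are independent $3$-torsion classes: if $\sum_i e_i[D_i]=0$ with $e_i\in\mathbb Z$, then $3\mid e_i$ for every $i$; 4. $\operatorname{rank}_3\operatorname{Jac}(C)(\mathbb Q)_{\mathrm{tors}}\ge 4$. -/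

import Mathlib

open Polynomial

noncomputable section

/-! ### Function fields of curves: places, divisors, degree zero class group -/

namespace CraigCurve

/-- A closed point of the nonsingular projective model of the function field `K / k` of a curve,
given by its normalized discrete valuation: a surjective valuation `K → ℤᵐ⁰` (written
multiplicatively) that is trivial on the field of constants `k`. -/
structure Place (k K : Type*) [Field k] [Field K] [Algebra k K] where
  val : Valuation K (WithZero (Multiplicative ℤ))
  val_algebraMap : ∀ c : k, c ≠ 0 → val (algebraMap k K c) = 1
  surjective : Function.Surjective val

variable {k K : Type*} [Field k] [Field K] [Algebra k K]

namespace Place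

/-- The order of vanishing at the place `v` (with the junk value `0` at `f = 0`). -/
def ord (v : Place k K) (f : K) : ℤ := -WithZero.log (v.val f)

theorem ord_one (v : Place k K) : v.ord 1 = 0 := by simp [ord]

theorem ord_mul (v : Place k K) {f g : K} (hf : f ≠ 0) (hg : g ≠ 0) :
    v.ord (f * g) = v.ord f + v.ord g := by
  have h1 : v.val f ≠ 0 := (Valuation.ne_zero_iff _).2 hf
  have h2 : v.val g ≠ 0 := (Valuation.ne_zero_iff _).2 hg
  simp only [ord, map_mul, WithZero.log_mul h1 h2]
  ring

theorem ord_inv (v : Place k K) {f : K} (hf : f ≠ 0) : v.ord f⁻¹ = -v.ord f := by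
  have h := v.ord_mul hf (inv_ne_zero hf)
  rw [mul_inv_cancel₀ hf, ord_one] at h
  linarith

/-- The local ring of functions that are regular at `v`. -/
def localRing (v : Place k K) : Subalgebra k K where
  carrier := {f | v.val f ≤ 1}
  mul_mem' := fun {a b} ha hb => by
    simp only [Set.mem_ofPred_eq, map_mul] at *
    exact mul_le_one' ha hb
  add_mem' := fun {a b} ha hb => (v.val.map_add a b).trans (max_le ha hb)
  algebraMap_mem' := fun c => by
    by_cases hc : c = 0
    · simp [hc]
    · exact (v.val_algebraMap c hc).le

/-- The ideal of functions that vanish at `v`. -/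
def maxIdeal (v : Place k K) : Ideal v.localRing where
  carrier := {f | v.val (f : K) < 1}
  add_mem' := fun {a b} ha hb => (v.val.map_add a b).trans_lt (max_lt ha hb)
  zero_mem' := by simp
  smul_mem' := fun c f hf => by
    have hc : v.val (c : K) ≤ 1 := c.2
    have hf' : v.val (f : K) < 1 := hf
    simp only [Set.mem_ofPred_eq, smul_eq_mul, MulMemClass.coe_mul, map_mul]
    exact (mul_le_of_le_one_left' hc).trans_lt hf'

/-- The degree of the closed point `v`: the degree of its residue field over `k`. -/
def degree (v : Place k K) : ℕ := Module.finrank k (v.localRing ⧸ v.maxIdeal)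

end Place

/-- Divisors: finite formal integer combinations of closed points. -/
abbrev Divisor (k K : Type*) [Field k] [Field K] [Algebra k K] : Type _ := Place k K →₀ ℤ

/-- `D` is the divisor of the nonzero rational function `f`. -/
def IsDivisorOf (f : K) (D : Divisor k K) : Prop := f ≠ 0 ∧ ∀ v : Place k K, D v = v.ord f

/-- The degree of a divisor. -/
def Divisor.degree : Divisor k K →+ ℤ :=
  Finsupp.liftAddHom fun v : Place k K => AddMonoidHom.mulRight (v.degree : ℤ)

variable (k K) in
/-- The group of divisors of degree zero. -/
abbrev Divisor.degreeZero : AddSubgroup (Divisor k K) := (Divisor.degree (k := k) (K := K)).ker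

variable (k K) in
/-- The group of principal divisors. -/
def Divisor.principal : AddSubgroup (Divisor k K) where
  carrier := {D | ∃ f : K, IsDivisorOf f D}
  zero_mem' := ⟨1, one_ne_zero, fun v => by simp [v.ord_one]⟩
  add_mem' := by
    rintro D E ⟨f, hf, hD⟩ ⟨g, hg, hE⟩
    exact ⟨f * g, mul_ne_zero hf hg, fun v => by
      rw [Finsupp.add_apply, hD, hE, v.ord_mul hf hg]⟩
  neg_mem' := by
    rintro D ⟨f, hf, hD⟩
    exact ⟨f⁻¹, inv_ne_zero hf, fun v => by rw [Finsupp.neg_apply, hD, v.ord_inv hf]⟩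

variable (k K) in
/-- Divisor classes of degree zero of the curve `C` over `k` with function field `K`. If `C` has a
`k`-rational point, as the curve below does (its point at infinity), this is the group
`Jac(C)(k)` of `k`-rational points of the Jacobian. -/
abbrev Jac : Type _ :=
  Divisor.degreeZero k K ⧸ (Divisor.principal k K).addSubgroupOf (Divisor.degreeZero k K)

/-- The `m`-rank of an abelian group `M`: the largest `r` (possibly infinite) such that
`(ℤ/mℤ)^r` embeds into `M`. -/
def mRank (m : ℕ) (M : Type*) [AddCommGroup M] : ℕ∞ :=
  ⨆ r ∈ {r : ℕ | ∃ φ : (Fin r → ZMod m) →+ M, Function.Injective φ}, (r : ℕ∞)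

/-! ### The parametric solution and the curve -/

/-- The sextic form `f`. -/
def form {R : Type*} [CommRing R] (x y z : R) : R :=
  x ^ 6 + y ^ 6 + z ^ 6 - 2 * x ^ 3 * y ^ 3 - 2 * x ^ 3 * z ^ 3 - 2 * y ^ 3 * z ^ 3

def polyA : ℚ[X] := 3 * X ^ 3 - 1

def polyB : ℚ[X] := 9 * X ^ 4 + 9 * X ^ 3 + 9 * X ^ 2 + 3 * X + 1

def polyC : ℚ[X] := 81 * X ^ 7 - 81 * X ^ 6 + 18 * X ^ 3 - 9 * X ^ 2 + 3 * X - 1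

def polyD : ℚ[X] := 81 * X ^ 8 - 54 * X ^ 5 - 9 * X ^ 4 + 9 * X ^ 2 + 3 * X + 2

def polyE : ℚ[X] := 81 * X ^ 8 + 81 * X ^ 7 - 27 * X ^ 5 - 45 * X ^ 4 - 9 * X ^ 3 + 3 * X + 1

def polyF : ℚ[X] := 81 * X ^ 10 + 81 * X ^ 9 + 81 * X ^ 8 - 27 * X ^ 7 - 45 * X ^ 6 - 63 * X ^ 5
  - 9 * X ^ 4 + 3 * X ^ 3 + 10 * X ^ 2 + 3 * X + 2

def polyG : ℚ[X] := 729 * X ^ 12 - 486 * X ^ 9 + 81 * X ^ 7 + 81 * X ^ 6 - 27 * X ^ 4 - 9 * X ^ 3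
  + 3 * X + 1

def polyH : ℚ[X] := 6561 * X ^ 16 + 13122 * X ^ 15 + 19683 * X ^ 14 + 13122 * X ^ 13
  + 3645 * X ^ 12 - 8019 * X ^ 11 - 9477 * X ^ 10 - 7047 * X ^ 9 - 1701 * X ^ 8 + 567 * X ^ 7
  + 1215 * X ^ 6 + 675 * X ^ 5 + 288 * X ^ 4 + 72 * X ^ 3 + 18 * X ^ 2 + 3 * X + 1

def polyI : ℚ[X] := 4782969 * X ^ 28 + 9565938 * X ^ 27 + 9565938 * X ^ 26 - 12754584 * X ^ 24
  - 16474671 * X ^ 23 - 10628820 * X ^ 22 + 1948617 * X ^ 21 + 8562105 * X ^ 20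
  + 9506889 * X ^ 19 + 4192479 * X ^ 18 - 98415 * X ^ 17 - 2768742 * X ^ 16 - 2322594 * X ^ 15
  - 1226907 * X ^ 14 - 48114 * X ^ 13 + 325863 * X ^ 12 + 334611 * X ^ 11 + 148716 * X ^ 10
  + 37179 * X ^ 9 - 13284 * X ^ 8 - 14904 * X ^ 7 - 8748 * X ^ 6 - 3024 * X ^ 5 - 864 * X ^ 4
  - 153 * X ^ 3 - 27 * X ^ 2 - 3 * X - 1

def x₀ : ℚ[X] := 9 * X ^ 2 * polyA ^ 2 * polyD * polyE

def y₀ : ℚ[X] := 9 * X ^ 2 * polyF * polyG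

def z₀ : ℚ[X] := polyC * polyH

def z₁ : ℚ[X] := 3 * X * polyA * polyB * polyC * polyE

def x₂ : ℚ[X] := -27 * X ^ 3 * polyA * polyD * polyF

def y₂ : ℚ[X] := -3 * X * polyA * polyE * polyG

def z₂ : ℚ[X] := -531441 * X ^ 23 - 531441 * X ^ 22 + 885735 * X ^ 20 + 1062882 * X ^ 19
  + 177147 * X ^ 18 - 551124 * X ^ 17 - 800442 * X ^ 16 - 255879 * X ^ 15 + 131220 * X ^ 14
  + 284310 * X ^ 13 + 134865 * X ^ 12 + 8019 * X ^ 11 - 44469 * X ^ 10 - 30375 * X ^ 9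
  - 8748 * X ^ 8 + 810 * X ^ 7 + 2349 * X ^ 6 + 1026 * X ^ 5 + 342 * X ^ 4 + 36 * X ^ 3
  + 18 * X ^ 2 + 1

/-- Polynomials in `t` as rational functions of `t`. -/
abbrev rat (p : ℚ[X]) : RatFunc ℚ := algebraMap ℚ[X] (RatFunc ℚ) p

/-- `x₁` and `y₁` are rational functions of `t` that are not polynomials. -/
def x₁ : RatFunc ℚ := rat (3 * X * polyA * polyD * polyH) / rat polyB

def y₁ : RatFunc ℚ := rat polyI / rat polyB

/-- The polynomial `h` in the equation `Y ^ 2 = h(t)` of the curve `C`. -/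
def h : ℚ[X] := form x₀ y₀ z₀

theorem h_not_square (b : RatFunc ℚ) : b ^ 2 ≠ rat h := by
  intro hb
  obtain ⟨q, hq⟩ := IsIntegrallyClosed.exists_algebraMap_eq_of_isIntegral_pow (R := ℚ[X])
    (x := b) two_pos (by rw [hb]; exact isIntegral_algebraMap)
  have h1 : q ^ 2 = h := by
    apply IsFractionRing.injective ℚ[X] (RatFunc ℚ)
    rw [map_pow, hq, hb]
  have h2 : h.eval 1 < 0 := by
    simp only [h, form, x₀, y₀, z₀, polyA, polyC, polyD, polyE, polyF, polyG, polyH, eval_add,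
      eval_sub, eval_mul, eval_pow, eval_X, eval_one, eval_ofNat]
    norm_num
  rw [← h1, eval_pow] at h2
  exact absurd h2 (not_lt.2 (sq_nonneg _))

instance : Fact (Irreducible (X ^ 2 - C (rat h) : (RatFunc ℚ)[X])) :=
  ⟨X_pow_sub_C_irreducible_of_prime Nat.prime_two h_not_square⟩

/-- The function field `ℚ(t)[Y] / (Y ^ 2 - h(t))` of the curve `C`. -/
abbrev FunField : Type := AdjoinRoot (X ^ 2 - C (rat h) : (RatFunc ℚ)[X])

/-- The coordinate function `Y` on `C`. -/
def Y : FunField := AdjoinRoot.root _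

/-- Rational functions of `t`, as functions on `C`. -/
abbrev onC (r : RatFunc ℚ) : FunField := algebraMap (RatFunc ℚ) FunField r

/-- The four functions on `C` whose divisors are divisible by `3`. -/
def g : Fin 4 → FunField :=
  ![Y + onC (rat (x₀ ^ 3 + y₀ ^ 3 - z₀ ^ 3)),
    Y + onC (rat (x₀ ^ 3 - y₀ ^ 3 + z₀ ^ 3)),
    Y + onC (x₁ ^ 3 + y₁ ^ 3 - rat z₁ ^ 3),
    Y + onC (rat (-x₂ ^ 3 + y₂ ^ 3 + z₂ ^ 3))]

end CraigCurve

end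

/-!
The four functions `g i` have divisors divisible by `3` because each of them is, up to a cube, `W
Y + U` with polynomials `W`, `U` whose norm `U ^ 2 - W ^ 2 h` to `ℚ(t)` is four times the cube of
a polynomial `N` prime to `U` (`polyU_sq_sub`). This is the identity `f(x, y, z) = (x ^ 3 + y ^ 3
- z ^ 3) ^ 2 - 4 (x y) ^ 3` (and its permutations) for the form `f` of the curve, applied to the
three points `(xᵢ, yᵢ, zᵢ)` at which `f` takes the same value `h`. At a finite place `W Y + U` and
its conjugate cannot both vanish, since `N` and `U` are coprime, so the order of `W Y + U` is the
order of its norm, or zero. Above infinity `h` has odd degree `141`, so `(W Y) ^ 2 = W ^ 2 h` and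
`U ^ 2` have different orders there, and the order of `W Y + U` is half the order of its norm
(`three_dvd_ord`).

Divisors are indexed here by abstract valuations, so the finiteness of the divisor of a function
`g`, and its degree being zero, have to be proved. For `g` transcendental over the constants, the
zeros of `g` are the primes above `g` in the integral closure of `k[g]` in `K`, and the
fundamental identity `∑ e f = n` computes their total degree as `[K : k(g)]`; the same holds for
`g⁻¹` (`exists_zeros_of_transcendental`). In particular a function without zeros is algebraic over
`ℚ`, and then constant, because `h` has odd degree.

For independence, a relation between the classes makes `∏ g i ^ e i` equal to `c F ^ 3` with a
constant `c` and a function `F`. Taking norms to `ℚ(t)` shows that `c`, multiplied by a suitable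
power of `4`, is a cube, so that a product of the functions `4 (W Y + U)` is a cube in the
function field (`exists_eq_cube_of_eq_mul_cube`). Its cube root is integral over `ℤ[t]`, and
becomes a polynomial in `t` and `Y` over `ℤ` when multiplied by `2 h`. Hence the value of the
product at any point of the curve over a finite field, with `Y ≠ 0` in odd characteristic, is a
cube (`exists_cube_eq_evalAt`). The cubic residue characters of the four functions at four points
modulo `19` form an invertible matrix modulo `3`, which forces `3 ∣ e i` for every `i`.

The computations with explicit polynomials are done on lists of integral coefficients, by kernel
evaluation. Coprimality over `ℚ` is deduced from coprimality modulo `7`.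
-/

noncomputable section

namespace CraigCurve

/-! ### Places and primes of Dedekind domains -/

section Dedekind

open IsDedekindDomain

variable {k S K : Type*} [Field k] [CommRing S] [IsDedekindDomain S] [Field K] [Algebra k S]
  [Algebra S K] [Algebra k K] [IsScalarTower k S K] [IsFractionRing S K]

variable (k K) in
/-- The place of `K` given by a nonzero prime of a Dedekind domain with fraction field `K`. -/
def Place.ofPrime (P : HeightOneSpectrum S) : Place k K where
  val := P.valuation K
  val_algebraMap c hc := by
    rw [IsScalarTower.algebraMap_apply k S K, HeightOneSpectrum.valuation_eq_one_iff_notMem]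
    exact fun h ↦ P.isPrime.ne_top
      (Ideal.eq_top_of_isUnit_mem _ h ((isUnit_iff_ne_zero.2 hc).map (algebraMap k S)))
  surjective := P.valuation_surjective K

theorem Place.ofPrime_injective :
    Function.Injective (Place.ofPrime k K : HeightOneSpectrum S → Place k K) := by
  intro P Q h
  have h' : P.valuation K = Q.valuation K := congrArg Place.val h
  apply HeightOneSpectrum.eq_of_valuation_isEquiv_valuation (K := K)
  rw [h']

theorem Place.ord_ofPrime (P : HeightOneSpectrum S) {a : S} (ha : a ≠ 0) :
    (Place.ofPrime k K P).ord (algebraMap S K a) =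
      multiplicity P.asIdeal (Ideal.span {a}) := by
  simp [Place.ord, Place.ofPrime, HeightOneSpectrum.valuation_of_algebraMap,
    HeightOneSpectrum.intValuation_eq_exp_neg_multiplicity P ha]

/-- The residue field of the place of a prime `P` of `S` is `S ⧸ P`. -/
theorem Place.degree_ofPrime (P : HeightOneSpectrum S) :
    (Place.ofPrime k K P).degree = Module.finrank k (S ⧸ P.asIdeal) := by
  set v := Place.ofPrime k K P with hv
  let f₀ : S →ₐ[k] v.localRing := (IsScalarTower.toAlgHom k S K).codRestrict v.localRing
    fun a ↦ P.valuation_le_one (K := K) a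
  let f : S →ₐ[k] v.localRing ⧸ v.maxIdeal := (Ideal.Quotient.mkₐ k v.maxIdeal).comp f₀
  have hker : RingHom.ker f = P.asIdeal := by
    ext a
    rw [RingHom.mem_ker]
    change Ideal.Quotient.mk v.maxIdeal (f₀ a) = 0 ↔ _
    rw [Ideal.Quotient.eq_zero_iff_mem]
    exact P.valuation_lt_one_iff_mem (K := K) a
  have hsurj : Function.Surjective f := by
    intro y
    obtain ⟨x, rfl⟩ := Ideal.Quotient.mk_surjective y
    obtain ⟨a, ha⟩ := P.exists_valuation_sub_lt_of_integer (K := K) (x := x) x.2 1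
    refine ⟨a, ?_⟩
    change Ideal.Quotient.mk v.maxIdeal (f₀ a) = _
    rw [← sub_eq_zero, ← map_sub, Ideal.Quotient.eq_zero_iff_mem]
    change v.val (algebraMap S K a - x) < 1
    exact ha
  have e := Ideal.quotientKerAlgEquivOfSurjective hsurj
  rw [← hker, e.toLinearEquiv.finrank_eq, Place.degree]

/-- A place that is regular on `S` and vanishes at a nonzero element of `S` comes from a prime
of `S`, the ideal of functions in `S` that vanish at it. -/
theorem Place.exists_ofPrime_eq (v : Place k K) (hv : ∀ a : S, v.val (algebraMap S K a) ≤ 1)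
    {a : S} (ha₀ : a ≠ 0) (ha : v.val (algebraMap S K a) < 1) :
    ∃ P : HeightOneSpectrum S, a ∈ P.asIdeal ∧ Place.ofPrime k K P = v := by
  let I : Ideal S :=
    { carrier := {b | v.val (algebraMap S K b) < 1}
      add_mem' := fun {b c} hb hc ↦ by
        simp only [Set.mem_ofPred_eq, map_add] at *
        exact (v.val.map_add _ _).trans_lt (max_lt hb hc)
      zero_mem' := by simp
      smul_mem' := fun c b hb ↦ by
        simp only [Set.mem_ofPred_eq, smul_eq_mul, map_mul] at *
        exact (mul_le_of_le_one_left' (hv c)).trans_lt hb }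
  have hI : ∀ b, b ∈ I ↔ v.val (algebraMap S K b) < 1 := fun b ↦ Iff.rfl
  have hprime : I.IsPrime := by
    refine ⟨fun h ↦ ?_, fun {b c} h ↦ ?_⟩
    · have := (hI 1).1 (h ▸ Submodule.mem_top)
      simp at this
    · by_contra! hbc
      rw [hI, hI, not_lt, not_lt] at hbc
      rw [hI, map_mul, map_mul] at h
      exact absurd h (not_lt.2 (one_le_mul hbc.1 hbc.2))
  let P : HeightOneSpectrum S := ⟨I, hprime, fun h ↦ ha₀ (by simpa [h] using (hI a).2 ha)⟩
  have hunit : ∀ b, b ∉ I → v.val (algebraMap S K b) = 1 := fun b hb ↦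
    le_antisymm (hv b) (not_lt.1 ((hI b).not.1 hb))
  -- the local ring at `P` is contained in the local ring at `v`
  have hle : ∀ x : K, P.valuation K x ≤ 1 → v.val x ≤ 1 := by
    intro x hx
    obtain ⟨n, d, hnd⟩ := P.exists_primeCompl_mul_eq_of_integer x hx
    have := congrArg v.val hnd
    rw [map_mul, hunit d d.2, mul_one] at this
    exact this ▸ hv n
  have hone : ∀ x : K, P.valuation K x = 1 → v.val x = 1 := by
    intro x hx
    refine le_antisymm (hle x hx.le) ?_
    have := hle x⁻¹ (by rw [map_inv₀, hx, inv_one])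
    rw [map_inv₀] at this
    have hx0 : v.val x ≠ 0 := by
      rw [Valuation.ne_zero_iff]; rintro rfl; simp at hx
    exact (inv_le_one₀ (zero_lt_iff.2 hx0)).1 this
  obtain ⟨π, hπ⟩ := P.valuation_exists_uniformizer K
  have hπ₀ : π ≠ 0 := by
    rintro rfl
    exact WithZero.exp_ne_zero (hπ.symm.trans (map_zero _))
  set m : ℤ := WithZero.log (v.val π) with hm
  have hvπ : v.val π = WithZero.exp m := (WithZero.exp_log ((Valuation.ne_zero_iff _).2 hπ₀)).symm
  -- every element is a power of `π` times a unit, so `v` is determined by its value at `π`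
  have key : ∀ x : K, x ≠ 0 → v.val x = WithZero.exp (-WithZero.log (P.valuation K x) * m) := by
    intro x hx
    have hPx : P.valuation K x ≠ 0 := (Valuation.ne_zero_iff _).2 hx
    set n := WithZero.log (P.valuation K x)
    have h1 : P.valuation K (x * π ^ n) = 1 := by
      rw [map_mul, map_zpow₀, hπ, ← WithZero.exp_zsmul, ← WithZero.exp_log hPx, ← WithZero.exp_add]
      simp [n]
    have h2 := hone _ h1
    rw [map_mul, map_zpow₀, hvπ, ← WithZero.exp_zsmul] at h2
    rw [eq_inv_of_mul_eq_one_left h2, ← WithZero.exp_neg, smul_eq_mul, neg_mul]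
  have hm1 : m = -1 := by
    have hle' : m < 0 := by
      obtain ⟨r, hr⟩ := P.valuation_exists_uniformizer' K
      have hr₀ : r ≠ 0 := by
        rintro rfl
        exact WithZero.exp_ne_zero (hr.symm.trans (by simp))
      have hrI : r ∈ I := (P.valuation_lt_one_iff_mem (K := K) r).1 (by
        change P.valuation K (algebraMap S K r) < 1
        rw [hr]; exact WithZero.exp_lt_exp.2 (by norm_num))
      have h3 := (hI r).1 hrI
      rw [key _ (by simpa using hr₀), hr] at h3
      simpa [← WithZero.exp_zero] using h3
    obtain ⟨x, hx⟩ := v.surjective (WithZero.exp (-1 : ℤ))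
    have hx₀ : x ≠ 0 := by
      rintro rfl
      exact WithZero.exp_ne_zero (hx.symm.trans (map_zero _))
    rw [key x hx₀, WithZero.exp_inj] at hx
    have hdvd : m ∣ 1 := ⟨WithZero.log (P.valuation K x), by linarith⟩
    rcases Int.isUnit_iff.1 (isUnit_of_dvd_one hdvd) with h | h <;> omega
  refine ⟨P, (hI a).2 ha, ?_⟩
  have hval : P.valuation K = v.val := by
    ext x
    by_cases hx : x = 0
    · simp [hx]
    · rw [key x hx, hm1, mul_neg_one, neg_neg, WithZero.exp_log ((Valuation.ne_zero_iff _).2 hx)]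
  cases v
  simp only [Place.ofPrime]
  congr

end Dedekind

/-! ### The degree of the divisor of a function -/

section Zeros

open IsDedekindDomain IntermediateField
open scoped IntermediateField.algebraAdjoinAdjoin

variable {k K : Type*} [Field k] [Field K] [Algebra k K]

theorem Place.val_lt_one_iff (v : Place k K) {f : K} (hf : f ≠ 0) :
    v.val f < 1 ↔ 0 < v.ord f := by
  rw [Place.ord, neg_pos, WithZero.log_lt_iff_lt_exp ((Valuation.ne_zero_iff _).2 hf),
    WithZero.exp_zero]

theorem Place.val_le_one_iff (v : Place k K) {f : K} (hf : f ≠ 0) :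
    v.val f ≤ 1 ↔ 0 ≤ v.ord f := by
  rw [Place.ord, neg_nonneg, WithZero.log_le_iff_le_exp ((Valuation.ne_zero_iff _).2 hf),
    WithZero.exp_zero]

theorem Place.val_le_one_of_isIntegral (v : Place k K) {R : Type*} [CommRing R] [Algebra R K]
    (hR : ∀ r : R, v.val (algebraMap R K r) ≤ 1) {x : K} (hx : IsIntegral R x) : v.val x ≤ 1 := by
  obtain ⟨P, hP, hPx⟩ := hx
  let φ : R →+* v.val.integer := (algebraMap R K).codRestrict v.val.integer hR
  have hx' : IsIntegral v.val.integer x := by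
    refine ⟨P.map φ, hP.map φ, ?_⟩
    rw [eval₂_map]
    exact hPx
  exact (Valuation.integer.integers v.val).mem_of_integral hx'

/-- The zeros of `γ ∈ k[γ] = R` on a curve are the primes above `γ` of a finite extension `S` of
`R`, and their number, counted with multiplicity, is the rank of `S`. -/
theorem exists_zeros_of_finite {R S : Type*} [CommRing R] [IsDomain R] [CommRing S]
    [IsDedekindDomain S] [Algebra k R] [Algebra k S] [Algebra R S] [Algebra R K] [Algebra S K]
    [IsScalarTower k R S] [IsScalarTower k S K] [IsScalarTower R S K] [IsScalarTower k R K]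
    [IsFractionRing S K] [Module.Finite R S] [Module.Flat R S]
    (γ : R) (hγ : algebraMap R K γ ≠ 0) (hR : Algebra.adjoin k {γ} = ⊤)
    (hp : (Ideal.span {γ}).IsMaximal) (hk : Function.Surjective (algebraMap k (R ⧸ Ideal.span {γ}))) :
    ∃ Z : Finset (Place k K), (∀ v, v ∈ Z ↔ 0 < v.ord (algebraMap R K γ)) ∧
      ∑ v ∈ Z, v.ord (algebraMap R K γ) * (v.degree : ℤ) = Module.finrank R S := by
  set g := algebraMap R K γ
  set p : Ideal R := Ideal.span {γ}
  have : Nontrivial (R ⧸ p) := Ideal.Quotient.nontrivial_iff.2 hp.ne_top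
  have hkp : Function.Bijective (algebraMap k (R ⧸ p)) := ⟨(algebraMap k (R ⧸ p)).injective, hk⟩
  let s : S := algebraMap R S γ
  have hsg : algebraMap S K s = g := (IsScalarTower.algebraMap_apply R S K γ).symm
  have hs₀ : s ≠ 0 := by
    intro h
    rw [h, map_zero] at hsg
    exact hγ hsg.symm
  have hmap : p.map (algebraMap R S) = Ideal.span {s} := by
    rw [Ideal.map_span, Set.image_singleton]
  have hsp : ∀ q : p.primesOver S, s ∈ q.1 := fun q ↦ by
    have := q.2.2.over
    exact Ideal.mem_comap.1 (this ▸ Ideal.mem_span_singleton_self γ : γ ∈ q.1.under R)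
  let toP : p.primesOver S → HeightOneSpectrum S := fun q ↦
    ⟨q.1, q.2.1, fun h ↦ hs₀ (by simpa [h] using hsp q)⟩
  have htoP : Function.Injective toP := fun q q' h ↦
    Subtype.ext (congrArg HeightOneSpectrum.asIdeal h)
  have : Finite (p.primesOver S) := inferInstance
  have := Fintype.ofFinite (p.primesOver S)
  refine ⟨Finset.univ.map ⟨fun q ↦ Place.ofPrime k K (toP q),
    Place.ofPrime_injective.comp htoP⟩, fun v ↦ ?_, ?_⟩
  · simp only [Finset.mem_map, Finset.mem_univ, true_and, Function.Embedding.coeFn_mk]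
    constructor
    · rintro ⟨q, rfl⟩
      rw [← Place.val_lt_one_iff _ hγ, ← hsg]
      exact ((toP q).valuation_lt_one_iff_mem (K := K) s).2 (hsp q)
    · intro hv
      rw [← Place.val_lt_one_iff _ hγ] at hv
      have hR1 : ∀ r : R, v.val (algebraMap R K r) ≤ 1 := by
        intro r
        have hr : r ∈ Algebra.adjoin k {γ} := hR ▸ Algebra.mem_top
        exact (Algebra.adjoin_le (S := v.localRing.comap (IsScalarTower.toAlgHom k R K))
          (Set.singleton_subset_iff.2 hv.le)) hr
      have hS1 : ∀ a : S, v.val (algebraMap S K a) ≤ 1 := fun a ↦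
        v.val_le_one_of_isIntegral hR1 ((Algebra.IsIntegral.isIntegral a).algebraMap)
      obtain ⟨P, hP, rfl⟩ := v.exists_ofPrime_eq hS1 hs₀ (by rwa [hsg])
      have hle : p ≤ P.asIdeal.under R := by
        rw [Ideal.span_singleton_le_iff_mem]
        exact hP
      refine ⟨⟨P.asIdeal, P.isPrime, ⟨hp.eq_of_le ?_ hle⟩⟩, rfl⟩
      exact Ideal.IsPrime.ne_top inferInstance
  · rw [Finset.sum_map, ← Ideal.sum_ramification_inertia_eq_finrank p S, Nat.cast_sum]
    refine Finset.sum_congr rfl fun q _ ↦ ?_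
    have hq : q.1.IsPrime := q.2.1
    have hover : q.1.LiesOver p := q.2.2
    have hmax : q.1.IsMaximal := (toP q).isMaximal
    have hram : (Place.ofPrime k K (toP q)).ord g = q.1.ramificationIdx R := by
      rw [← hsg, Place.ord_ofPrime _ hs₀,
        Ideal.IsDedekindDomain.ramificationIdx_eq_multiplicity p q.1 (by simpa [hmap] using hs₀), hmap]
    have hdeg : (Place.ofPrime k K (toP q)).degree = q.1.inertiaDeg R := by
      rw [Place.degree_ofPrime, Ideal.inertiaDeg_eq_of_isMaximal p q.1]
      exact Algebra.finrank_eq_of_equiv_equiv (RingEquiv.ofBijective _ hkp) (RingEquiv.refl _) <| by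
        ext c
        change Ideal.Quotient.mk q.1 (algebraMap R S (algebraMap k R c)) =
          Ideal.Quotient.mk q.1 (algebraMap k S c)
        rw [← IsScalarTower.algebraMap_apply]
    rw [Function.Embedding.coeFn_mk, hram, hdeg, Nat.cast_mul]

/-- A transcendental function `g` on a curve has finitely many zeros, and they number `[K : k(g)]`,
counted with multiplicity. The zeros are the primes above `g` of the integral closure of `k[g]`
in `K`, so that the fundamental identity `∑ e f = n` applies. -/
theorem exists_zeros_of_transcendental [CharZero k] {g : K} (hg : Transcendental k g)
    [FiniteDimensional k⟮g⟯ K] :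
    ∃ Z : Finset (Place k K), (∀ v, v ∈ Z ↔ 0 < v.ord g) ∧
      ∑ v ∈ Z, v.ord g * (v.degree : ℤ) = Module.finrank k⟮g⟯ K := by
  have hg₀ : g ≠ 0 := by
    rintro rfl
    exact hg isAlgebraic_zero
  set R := Algebra.adjoin k {g} with hR
  let γ : R := ⟨g, Algebra.self_mem_adjoin_singleton k g⟩
  let e : k[X] ≃ₐ[k] R :=
    AlgEquiv.ofBijective ((aeval g).codRestrict R fun p ↦ aeval_mem_adjoin_singleton k g) (by
      constructor
      · exact fun a b h ↦ transcendental_iff_injective.1 hg (congrArg Subtype.val h)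
      · rintro ⟨x, hx⟩
        rw [hR, Algebra.adjoin_singleton_eq_range_aeval] at hx
        obtain ⟨p, rfl⟩ := hx
        exact ⟨p, rfl⟩)
  have heX : e X = γ := Subtype.ext (aeval_X g)
  have : IsPrincipalIdealRing R := IsPrincipalIdealRing.of_surjective e e.surjective
  let S := integralClosure R K
  have : IsDedekindDomain S := integralClosure.isDedekindDomain R k⟮g⟯ K
  have : IsFractionRing S K := IsIntegralClosure.isFractionRing_of_finite_extension R k⟮g⟯ K S
  have : Module.Finite R S := IsIntegralClosure.finite R k⟮g⟯ K S
  have : Module.Free R S := IsIntegralClosure.module_free R k⟮g⟯ K S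
  have hrank : Module.finrank R S = Module.finrank k⟮g⟯ K := IsIntegralClosure.rank R k⟮g⟯ K S
  let p : Ideal R := Ideal.span {γ}
  have hp : p.IsMaximal := by
    apply PrincipalIdealRing.isMaximal_of_irreducible
    rw [← heX]
    exact (MulEquiv.irreducible_iff e).2 irreducible_X
  have hk : Function.Surjective (algebraMap k (R ⧸ p)) := by
    intro y
    obtain ⟨r, rfl⟩ := Ideal.Quotient.mk_surjective y
    obtain ⟨f, rfl⟩ := e.surjective r
    refine ⟨f.coeff 0, ?_⟩
    change Ideal.Quotient.mk p (algebraMap k R (f.coeff 0)) = _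
    rw [eq_comm, Ideal.Quotient.eq, Ideal.mem_span_singleton, ← heX,
      ← e.commutes, algebraMap_eq, ← map_sub]
    exact map_dvd e (X_dvd_sub_C)
  have htop : Algebra.adjoin k {γ} = ⊤ := by
    rw [← heX, ← Set.image_singleton, ← AlgEquiv.coe_toAlgHom, ← AlgHom.map_adjoin, adjoin_X,
      Algebra.map_top, AlgHom.range_eq_top]
    exact e.surjective
  have := exists_zeros_of_finite (k := k) (K := K) (S := S) γ hg₀ htop hp hk
  rwa [hrank] at this

end Zeros

section DegreeZero

open IntermediateField

variable {k K : Type*} [Field k] [Field K] [Algebra k K]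

/-- A transcendental function on a curve has as many zeros as poles, since
`k(g) = k(g⁻¹)`. -/
theorem exists_divisor_of_transcendental [CharZero k] {g : K} (hg : Transcendental k g)
    [FiniteDimensional k⟮g⟯ K] :
    ∃ D : Divisor k K, IsDivisorOf g D ∧ Divisor.degree D = 0 := by
  classical
  have hg₀ : g ≠ 0 := by
    rintro rfl
    exact hg isAlgebraic_zero
  have hinv : k⟮g⁻¹⟯ = k⟮g⟯ := by
    apply le_antisymm <;> rw [adjoin_simple_le_iff]
    · exact inv_mem (mem_adjoin_simple_self k g)
    · simpa only [inv_inv] using inv_mem (mem_adjoin_simple_self k g⁻¹)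
  have : FiniteDimensional k⟮g⁻¹⟯ K := by rwa [hinv]
  obtain ⟨Z, hZ, hZdeg⟩ := exists_zeros_of_transcendental hg
  obtain ⟨W, hW, hWdeg⟩ := exists_zeros_of_transcendental (g := g⁻¹)
    (fun h ↦ hg (inv_inv g ▸ h.inv))
  simp only [Place.ord_inv _ hg₀] at hW hWdeg
  have hdisj : Disjoint Z W := by
    rw [Finset.disjoint_left]
    intro v hv hv'
    have h1 := (hZ v).1 hv
    have h2 := (hW v).1 hv'
    omega
  refine ⟨Finsupp.onFinset (Z ∪ W) (fun v ↦ v.ord g) fun v hv ↦ ?_, ⟨hg₀, fun v ↦ rfl⟩, ?_⟩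
  · rw [Finset.mem_union, hZ, hW]
    omega
  · change (Finsupp.onFinset _ _ _).sum (fun (v : Place k K) n ↦ n * (v.degree : ℤ)) = 0
    rw [Finsupp.onFinset_sum _ fun _ ↦ zero_mul _, Finset.sum_union hdisj, hZdeg]
    rw [hinv] at hWdeg
    rw [← hWdeg, ← Finset.sum_add_distrib]
    exact Finset.sum_eq_zero fun v _ ↦ by ring

theorem exists_ord_pos_of_transcendental [CharZero k] {g : K} (hg : Transcendental k g)
    [FiniteDimensional k⟮g⟯ K] : ∃ v : Place k K, 0 < v.ord g := by
  obtain ⟨Z, hZ, hZdeg⟩ := exists_zeros_of_transcendental hg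
  by_contra! h
  have : Z = ∅ := Finset.eq_empty_of_forall_notMem fun v hv ↦ (h v).not_gt ((hZ v).1 hv)
  rw [this, Finset.sum_empty] at hZdeg
  have h1 : 0 < Module.finrank k⟮g⟯ K := Module.finrank_pos
  omega

/-- A function field of transcendence degree one is finite over each subfield generated by a
transcendental function. -/
theorem finiteDimensional_adjoin_of_transcendental [Algebra.EssFiniteType k K]
    (htr : Algebra.trdeg k K ≤ 1) {g : K} (hg : Transcendental k g) :
    FiniteDimensional k⟮g⟯ K := by
  have hx : AlgebraicIndependent k (fun _ : Unit ↦ g) :=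
    algebraicIndependent_unique_type_iff.2 hg
  have hb : IsTranscendenceBasis k (fun _ : Unit ↦ g) := by
    apply hx.isTranscendenceBasis_of_lift_trdeg_le_of_finite
    simpa using htr
  have h1 := hb.isAlgebraic_field
  rw [Set.range_const] at h1
  have : Algebra.EssFiniteType k⟮g⟯ K := Algebra.EssFiniteType.of_comp k k⟮g⟯ K
  exact Algebra.finite_of_essFiniteType_of_isAlgebraic

/-- A finite extension of `k(t)` is finite over each subfield generated by a transcendental
function. -/
theorem finiteDimensional_adjoin_of_finite_ratFunc [Algebra (RatFunc k) K]
    [Module.Finite (RatFunc k) K]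
    (halg : ∀ c : k, algebraMap k K c = algebraMap (RatFunc k) K (algebraMap k (RatFunc k) c))
    {g : K} (hg : Transcendental k g) : FiniteDimensional k⟮g⟯ K := by
  have : IsScalarTower k (RatFunc k) K := .of_algebraMap_eq halg
  have : Algebra.EssFiniteType k[X] (RatFunc k) := .of_isLocalization _ (nonZeroDivisors k[X])
  have : Algebra.EssFiniteType k (RatFunc k) := .comp k k[X] (RatFunc k)
  have : Algebra.EssFiniteType k K := .comp k (RatFunc k) K
  let : Algebra k[X] K := ((algebraMap (RatFunc k) K).comp (algebraMap k[X] (RatFunc k))).toAlgebra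
  have : IsScalarTower k[X] (RatFunc k) K := .of_algebraMap_eq fun _ ↦ rfl
  have : FaithfulSMul k[X] K := (faithfulSMul_iff_algebraMap_injective _ _).2
    ((algebraMap (RatFunc k) K).injective.comp (IsFractionRing.injective k[X] (RatFunc k)))
  have : IsScalarTower k k[X] K := .of_algebraMap_eq fun c ↦ by
    rw [halg, IsScalarTower.algebraMap_apply k k[X] (RatFunc k)]
    rfl
  have : Algebra.IsAlgebraic k[X] (RatFunc k) :=
    IsLocalization.isAlgebraic _ (nonZeroDivisors k[X])
  have : Algebra.IsAlgebraic k[X] K := .trans k[X] (RatFunc k) K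
  have htr := lift_trdeg_add_eq k k[X] K
  rw [trdeg_eq_zero (R := k[X]), Polynomial.trdeg_of_isDomain] at htr
  exact finiteDimensional_adjoin_of_transcendental (by simpa using htr.ge) hg

end DegreeZero

/-! ### The function field of the curve -/

instance : Module.Finite (RatFunc ℚ) FunField :=
  (monic_X_pow_sub_C (rat h) two_ne_zero).finite_adjoinRoot

theorem algebraMap_funField (c : ℚ) : algebraMap ℚ FunField c = onC (rat (C c)) :=
  congrFun (congrArg DFunLike.coe (RingHom.ext_rat (algebraMap ℚ FunField)
    (((algebraMap (RatFunc ℚ) FunField).comp (algebraMap ℚ[X] (RatFunc ℚ))).comp C))) c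

theorem finiteDimensional_funField {g : FunField} (hg : Transcendental ℚ g) :
    FiniteDimensional (IntermediateField.adjoin ℚ {g}) FunField := by
  refine finiteDimensional_adjoin_of_finite_ratFunc (fun c ↦ ?_) hg
  rw [algebraMap_funField]
  congr 1

theorem Y_sq : Y ^ 2 = onC (rat h) := by
  have := AdjoinRoot.eval₂_root (X ^ 2 - C (rat h) : (RatFunc ℚ)[X])
  rw [eval₂_sub, eval₂_pow, eval₂_X, eval₂_C, sub_eq_zero] at this
  exact this

theorem exists_eq_onC_add (F : FunField) : ∃ a b : RatFunc ℚ, F = onC a + onC b * Y := by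
  have hm := monic_X_pow_sub_C (rat h) two_ne_zero
  obtain ⟨p, rfl⟩ := AdjoinRoot.mk_surjective F
  refine ⟨(p %ₘ (X ^ 2 - C (rat h))).coeff 0, (p %ₘ (X ^ 2 - C (rat h))).coeff 1, ?_⟩
  have hdeg : (p %ₘ (X ^ 2 - C (rat h))).natDegree ≤ 1 := by
    have := natDegree_modByMonic_lt p hm (fun h1 ↦ by
      have := congrArg natDegree h1
      rw [natDegree_X_pow_sub_C, natDegree_one] at this
      omega)
    rw [natDegree_X_pow_sub_C] at this
    omega
  have h1 := eq_X_add_C_of_natDegree_le_one hdeg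
  have h2 : AdjoinRoot.mk (X ^ 2 - C (rat h)) p =
      AdjoinRoot.mk (X ^ 2 - C (rat h)) (p %ₘ (X ^ 2 - C (rat h))) := by
    rw [AdjoinRoot.mk_eq_mk]
    exact ⟨p /ₘ (X ^ 2 - C (rat h)), by
      rw [sub_eq_iff_eq_add, add_comm, modByMonic_add_div]⟩
  rw [h2]
  conv_lhs => rw [h1]
  rw [map_add, map_mul, add_comm]
  rfl

theorem onC_mul (a b : RatFunc ℚ) : onC (a * b) = onC a * onC b := map_mul _ _ _

theorem onC_pow (a : RatFunc ℚ) (n : ℕ) : onC (a ^ n) = onC a ^ n := map_pow _ _ _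

theorem onC_injective : Function.Injective onC := (algebraMap (RatFunc ℚ) FunField).injective

/-- `1` and `Y` are linearly independent over `ℚ(t)`. -/
theorem eq_zero_of_onC_add_eq_zero {a b : RatFunc ℚ} (hab : onC a + onC b * Y = 0) :
    a = 0 ∧ b = 0 := by
  have hb : b = 0 := by
    by_contra hb
    apply h_not_square (-a / b)
    apply onC_injective
    have hb' : onC b ≠ 0 := fun h0 ↦ hb (onC_injective (h0.trans (map_zero _).symm))
    rw [← Y_sq]
    simp only [onC, map_pow, map_div₀, map_neg]
    rw [← eq_neg_of_add_eq_zero_right hab,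
      mul_div_cancel_left₀ _ hb']
  subst hb
  refine ⟨onC_injective ?_, rfl⟩
  simpa using hab

/-- The hyperelliptic involution `Y ↦ -Y`. -/
def conj : FunField →+* FunField :=
  AdjoinRoot.lift (algebraMap (RatFunc ℚ) FunField) (-Y) (by
    rw [eval₂_sub, eval₂_pow, eval₂_X, eval₂_C, neg_sq, Y_sq, sub_self])

theorem conj_Y : conj Y = -Y := AdjoinRoot.lift_root _

theorem conj_onC (a : RatFunc ℚ) : conj (onC a) = onC a := AdjoinRoot.lift_of _

theorem exists_eq_C_of_eval₂_eq_zero {k : Type*} [Field k] {x : RatFunc k} {p : k[X]} (hp : p ≠ 0)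
    (hx : p.eval₂ RatFunc.C x = 0) : ∃ c : k, x = RatFunc.C c := by
  by_contra hc
  exact RatFunc.transcendental_of_ne_C x hc ⟨p, hp, hx⟩

theorem exists_eq_C_of_isAlgebraic_onC {x : RatFunc ℚ} (hx : IsAlgebraic ℚ (onC x)) :
    ∃ c : ℚ, x = rat (C c) := by
  obtain ⟨p, hp, hpx⟩ := hx
  refine exists_eq_C_of_eval₂_eq_zero hp (onC_injective ?_)
  rw [aeval_def, eval₂_eq_sum] at *
  simp only [onC, map_sum, Polynomial.sum, map_mul, map_pow, map_zero] at *
  rw [← hpx]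
  refine Finset.sum_congr rfl fun n _ ↦ ?_
  rw [algebraMap_funField]
  rfl

/-- The field of constants of the curve is `ℚ`, because `h` has odd degree. -/
theorem exists_eq_algebraMap_of_isAlgebraic (hdeg : Odd h.natDegree) {F : FunField}
    (hF : IsAlgebraic ℚ F) : ∃ c : ℚ, F = algebraMap ℚ FunField c := by
  obtain ⟨a, b, rfl⟩ := exists_eq_onC_add F
  have hF' : IsAlgebraic ℚ (onC a - onC b * Y) := by
    have := hF.algHom conj.toRatAlgHom
    simpa [conj_Y, conj_onC, sub_eq_add_neg] using this
  have h2 : IsAlgebraic ℚ (2 : FunField) := by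
    simpa using isAlgebraic_algebraMap (R := ℚ) (A := FunField) 2
  have h20 : (2 : FunField) ≠ 0 := by
    rw [← map_ofNat (algebraMap ℚ FunField) 2]
    exact (_root_.map_ne_zero _).2 two_ne_zero
  have ha : IsAlgebraic ℚ (onC a) := by
    have := (hF.add hF').mul h2.inv
    rwa [add_add_sub_cancel, ← mul_two, mul_inv_cancel_right₀ h20] at this
  have hb : IsAlgebraic ℚ (onC (b ^ 2 * rat h)) := by
    have := (hF.sub ha).pow 2
    rwa [show (onC a + onC b * Y - onC a) ^ 2 = onC (b ^ 2 * rat h) by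
      rw [onC_mul, onC_pow, ← Y_sq]; ring] at this
  obtain ⟨c, hc⟩ := exists_eq_C_of_isAlgebraic_onC ha
  obtain ⟨d, hd⟩ := exists_eq_C_of_isAlgebraic_onC hb
  refine ⟨c, ?_⟩
  have hb₀ : b = 0 := by
    by_contra hb₀
    have hh : rat h ≠ 0 := fun h0 ↦ h_not_square 0 (by rw [h0]; ring)
    have := congrArg RatFunc.intDegree hd
    rw [RatFunc.intDegree_mul (pow_ne_zero 2 hb₀) hh, sq, RatFunc.intDegree_mul hb₀ hb₀,
      RatFunc.intDegree_polynomial, RatFunc.intDegree_polynomial, natDegree_C] at this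
    obtain ⟨n, hn⟩ := hdeg
    omega
  rw [algebraMap_funField, ← hc, hb₀]
  simp

/-- Polynomials in `t`, as functions on the curve. -/
def ofPoly : ℚ[X] →+* FunField :=
  (algebraMap (RatFunc ℚ) FunField).comp (algebraMap ℚ[X] (RatFunc ℚ))

theorem ofPoly_apply (p : ℚ[X]) : ofPoly p = onC (rat p) := rfl

theorem ofPoly_injective : Function.Injective ofPoly :=
  onC_injective.comp (IsFractionRing.injective ℚ[X] (RatFunc ℚ))

theorem ofPoly_ne_zero {p : ℚ[X]} (hp : p ≠ 0) : ofPoly p ≠ 0 :=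
  (map_ne_zero_iff _ ofPoly_injective).2 hp

theorem ofPoly_eq_aeval (p : ℚ[X]) : ofPoly p = aeval (ofPoly X) p := by
  rw [← AlgHom.coe_toRingHom]
  congr 1
  apply Polynomial.ringHom_ext'
  · exact RingHom.ext_rat _ _
  · simp

theorem Y_sq_eq_ofPoly : Y ^ 2 = ofPoly h := Y_sq

theorem conj_ofPoly (p : ℚ[X]) : conj (ofPoly p) = ofPoly p := conj_onC _

/-! ### The order of `W Y + U` at the places of the curve -/

section Order

theorem Place.ord_pow {k K : Type*} [Field k] [Field K] [Algebra k K] (v : Place k K) (f : K)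
    (n : ℕ) : v.ord (f ^ n) = n * v.ord f := by
  simp [Place.ord, WithZero.log_pow]

theorem Place.ord_algebraMap {k K : Type*} [Field k] [Field K] [Algebra k K] (v : Place k K)
    (c : k) : v.ord (algebraMap k K c) = 0 := by
  by_cases hc : c = 0
  · simp [Place.ord, hc]
  · simp [Place.ord, v.val_algebraMap c hc]

variable (v : Place ℚ FunField)

theorem Place.ord_four_mul_pow {N : ℚ[X]} (hN : N ≠ 0) :
    v.ord (ofPoly (4 * N ^ 3)) = 3 * v.ord (ofPoly N) := by
  have h4 : ofPoly (4 : ℚ[X]) = algebraMap ℚ FunField 4 := by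
    rw [map_ofNat, map_ofNat]
  rw [map_mul, map_pow, v.ord_mul (ofPoly_ne_zero (by norm_num))
    (pow_ne_zero 3 (ofPoly_ne_zero hN)), v.ord_pow, h4, v.ord_algebraMap]
  norm_num

/-- At a pole of `t`, the order of a polynomial is determined by its degree. -/
theorem Place.ord_ofPoly_of_one_lt (hv : 1 < v.val (ofPoly X)) {p : ℚ[X]} (hp : p ≠ 0) :
    v.ord (ofPoly p) = p.natDegree * v.ord (ofPoly X) := by
  have : Valuation.IsTrivialOn ℚ v.val := ⟨v.val_algebraMap⟩
  rw [ofPoly_eq_aeval p, Place.ord, Place.ord,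
    valuation_aeval_eq_valuation_X_pow_natDegree_of_one_lt_valuation_X _ hv hp, WithZero.log_pow]
  simp

theorem Place.val_ofPoly_le_one (hv : v.val (ofPoly X) ≤ 1) (p : ℚ[X]) :
    v.val (ofPoly p) ≤ 1 := by
  rw [ofPoly_eq_aeval]
  exact Algebra.adjoin_le (S := v.localRing) (Set.singleton_subset_iff.2 hv)
    (aeval_mem_adjoin_singleton ℚ _)

theorem ofPoly_mul_Y_add_ne_zero {W U : ℚ[X]} (hW : W ≠ 0) : ofPoly W * Y + ofPoly U ≠ 0 := by
  intro h0
  rw [add_comm] at h0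
  exact hW (IsFractionRing.injective ℚ[X] (RatFunc ℚ)
    ((eq_zero_of_onC_add_eq_zero h0).2.trans (map_zero _).symm))

theorem mul_conj_eq {W U N : ℚ[X]} (hN : U ^ 2 - W ^ 2 * h = 4 * N ^ 3) :
    (ofPoly W * Y + ofPoly U) * (ofPoly (-W) * Y + ofPoly U) = ofPoly (4 * N ^ 3) := by
  rw [← hN]
  simp only [map_neg, map_sub, map_mul, map_pow, ← Y_sq_eq_ofPoly]
  ring

/-- If `U ^ 2 - W ^ 2 h = 4 N ^ 3` with `N` and `U` coprime, then all orders of `W Y + U` are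
multiples of `3`. At a place where `t` is regular `W Y + U` and its conjugate `-W Y + U` do not
both vanish, since their sum is `2 U` and their product `4 N ^ 3`. At a pole of `t` they have the
same order, since the orders of `W Y` and `U` differ, `h` being of odd degree. -/
theorem three_dvd_ord (hdeg : Odd h.natDegree) {W U N : ℚ[X]} (hW : W ≠ 0) (hN₀ : N ≠ 0)
    (hN : U ^ 2 - W ^ 2 * h = 4 * N ^ 3) (hco : IsCoprime N U) :
    3 ∣ v.ord (ofPoly W * Y + ofPoly U) := by
  set G := ofPoly W * Y + ofPoly U with hG
  set G' := ofPoly (-W) * Y + ofPoly U with hG'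
  have hG₀ : G ≠ 0 := ofPoly_mul_Y_add_ne_zero hW
  have hG'₀ : G' ≠ 0 := ofPoly_mul_Y_add_ne_zero (neg_ne_zero.2 hW)
  have hmul : G * G' = ofPoly (4 * N ^ 3) := mul_conj_eq hN
  have hord : v.ord G + v.ord G' = 3 * v.ord (ofPoly N) := by
    rw [← v.ord_mul hG₀ hG'₀, hmul, v.ord_four_mul_pow hN₀]
  have hh : h ≠ 0 := by
    rintro h0
    simp [h0] at hdeg
  have hY₀ : Y ≠ 0 := by
    intro h0
    apply ofPoly_ne_zero hh
    rw [← Y_sq_eq_ofPoly, h0]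
    ring
  rcases le_or_gt (v.val (ofPoly X)) 1 with hv | hv
  · have hp := v.val_ofPoly_le_one hv
    have hY : v.val Y ≤ 1 := by
      rw [← pow_le_one_iff two_ne_zero, ← map_pow, Y_sq_eq_ofPoly]
      exact hp h
    have hint : ∀ V : ℚ[X], v.val (ofPoly V * Y + ofPoly U) ≤ 1 := fun V ↦
      (v.val.map_add _ _).trans (max_le (by rw [map_mul]; exact mul_le_one' (hp V) hY) (hp U))
    have h1 : 0 ≤ v.ord G := (v.val_le_one_iff hG₀).1 (hint W)
    have h2 : 0 ≤ v.ord G' := (v.val_le_one_iff hG'₀).1 (hint (-W))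
    have h3 : ¬ (0 < v.ord G ∧ 0 < v.ord G') := by
      rintro ⟨h3, h4⟩
      have hN1 : v.val (ofPoly N) < 1 := by
        rw [v.val_lt_one_iff (ofPoly_ne_zero hN₀)]
        omega
      have hU1 : v.val (ofPoly U) < 1 := by
        have h5 : ofPoly U = ofPoly (C (1 / 2)) * (G + G') := by
          have : ofPoly (C (1 / 2)) * 2 = 1 := by
            rw [← map_ofNat ofPoly 2, ← map_mul, ← map_ofNat C 2, ← C_mul]
            norm_num
          rw [hG, hG', map_neg]
          linear_combination (-ofPoly U) * this
        rw [h5, map_mul]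
        refine (mul_le_of_le_one_left' (hp _)).trans_lt ((v.val.map_add _ _).trans_lt ?_)
        exact max_lt ((v.val_lt_one_iff hG₀).2 h3) ((v.val_lt_one_iff hG'₀).2 h4)
      obtain ⟨a, b, hab⟩ := hco
      have h6 := congrArg (fun p ↦ v.val (ofPoly p)) hab
      simp only [map_add, map_mul, map_one] at h6
      refine absurd h6 (ne_of_lt ((v.val.map_add _ _).trans_lt (max_lt ?_ ?_))) <;> rw [map_mul]
      · exact (mul_le_of_le_one_left' (hp a)).trans_lt hN1
      · exact (mul_le_of_le_one_left' (hp b)).trans_lt hU1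
    omega
  · have hτ : v.ord (ofPoly X) ≠ 0 := by
      intro h0
      have := (v.val_le_one_iff (ofPoly_ne_zero X_ne_zero)).2 h0.ge
      exact absurd this (not_le.2 hv)
    have hne : ∀ V : ℚ[X], V ≠ 0 → v.val (ofPoly V * Y) ≠ v.val (ofPoly U) := by
      intro V hV h0
      have hVY : ofPoly V * Y ≠ 0 := mul_ne_zero (ofPoly_ne_zero hV) hY₀
      have hU₀ : U ≠ 0 := by
        rintro rfl
        rw [map_zero, map_zero, Valuation.zero_iff] at h0
        exact hVY h0
      have h7 : v.ord (ofPoly V * Y) = v.ord (ofPoly U) := by rw [Place.ord, h0, Place.ord]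
      have h8 : 2 * v.ord Y = h.natDegree * v.ord (ofPoly X) := by
        rw [← v.ord_ofPoly_of_one_lt hv hh, ← Y_sq_eq_ofPoly, v.ord_pow, Nat.cast_ofNat]
      rw [v.ord_mul (ofPoly_ne_zero hV) hY₀, v.ord_ofPoly_of_one_lt hv hV,
        v.ord_ofPoly_of_one_lt hv hU₀] at h7
      obtain ⟨n, hn⟩ := hdeg
      rw [hn] at h8
      have h9 : (2 * (V.natDegree + n - U.natDegree : ℤ) + 1) * v.ord (ofPoly X) = 0 := by
        push_cast at h8
        linear_combination 2 * h7 - h8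
      rcases mul_eq_zero.1 h9 with h9 | h9
      · omega
      · exact hτ h9
    have heq : v.val G = v.val G' := by
      rw [hG, hG', v.val.map_add_of_distinct_val (hne W hW),
        v.val.map_add_of_distinct_val (hne (-W) (neg_ne_zero.2 hW)), map_neg, neg_mul,
        Valuation.map_neg]
    have : v.ord G = v.ord G' := by rw [Place.ord, heq, Place.ord]
    omega

end Order

/-- If all orders of a function are multiples of `3`, its divisor is three times a divisor of
degree zero. -/
theorem exists_degreeZero_of_three_dvd_ord (hdeg : Odd h.natDegree) {g : FunField} (hg : g ≠ 0)
    (h3 : ∀ v : Place ℚ FunField, 3 ∣ v.ord g) :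
    ∃ D : Divisor.degreeZero ℚ FunField, IsDivisorOf g (3 • (D : Divisor ℚ FunField)) := by
  have hD : ∃ D : Divisor ℚ FunField, IsDivisorOf g D ∧ Divisor.degree D = 0 := by
    by_cases halg : IsAlgebraic ℚ g
    · obtain ⟨c, rfl⟩ := exists_eq_algebraMap_of_isAlgebraic hdeg halg
      exact ⟨0, ⟨hg, fun v ↦ (v.ord_algebraMap c).symm⟩, map_zero _⟩
    · have := finiteDimensional_funField halg
      exact exists_divisor_of_transcendental halg
  obtain ⟨D, hD, hD0⟩ := hD
  let E : Divisor ℚ FunField := D.mapRange (· / 3) (by norm_num)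
  have hE : 3 • E = D := by
    ext v
    rw [Finsupp.smul_apply, Finsupp.mapRange_apply, hD.2 v, nsmul_eq_mul]
    exact Int.mul_ediv_cancel' (h3 v)
  refine ⟨⟨E, ?_⟩, by rwa [hE]⟩
  have : 3 • Divisor.degree E = 0 := by rw [← map_nsmul, hE, hD0]
  rw [AddMonoidHom.mem_ker]
  simpa using this

/-- A function without zeros and poles is constant. -/
theorem exists_eq_algebraMap_of_ord_eq_zero (hdeg : Odd h.natDegree) {g : FunField}
    (h0 : ∀ v : Place ℚ FunField, v.ord g = 0) : ∃ c : ℚ, g = algebraMap ℚ FunField c := by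
  by_cases halg : IsAlgebraic ℚ g
  · exact exists_eq_algebraMap_of_isAlgebraic hdeg halg
  · have := finiteDimensional_funField halg
    obtain ⟨v, hv⟩ := exists_ord_pos_of_transcendental halg
    exact absurd (h0 v) hv.ne'

/-! ### Computation with lists of coefficients -/

/-- The polynomial over `R` with the given list of integral coefficients, constant term first.
Identities between explicit polynomials are checked by evaluating lists of coefficients. -/
def ofCoeffs (R : Type*) [CommRing R] : List ℤ → R[X]
  | [] => 0
  | a :: l => (a : R[X]) + X * ofCoeffs R l

/-- Coefficients of a sum. -/
def coeffAdd : List ℤ → List ℤ → List ℤ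
  | [], m => m
  | a :: l, [] => a :: l
  | a :: l, b :: m => (a + b) :: coeffAdd l m

/-- Coefficients of a multiple by an integer. -/
def coeffScale (c : ℤ) (l : List ℤ) : List ℤ := l.map (c * ·)

/-- Coefficients of a product. -/
def coeffMul : List ℤ → List ℤ → List ℤ
  | [], _ => []
  | a :: l, m => coeffAdd (coeffScale a m) (0 :: coeffMul l m)

/-- Coefficients of a power. -/
def coeffPow (l : List ℤ) : ℕ → List ℤ
  | 0 => [1]
  | n + 1 => coeffMul l (coeffPow l n)

/-- Value at an integer. -/
def coeffEval (t : ℤ) : List ℤ → ℤ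
  | [] => 0
  | a :: l => a + t * coeffEval t l

section Lists

variable {R : Type*} [CommRing R]

theorem ofCoeffs_coeffAdd (l m : List ℤ) :
    ofCoeffs R (coeffAdd l m) = ofCoeffs R l + ofCoeffs R m := by
  induction l generalizing m with
  | nil => simp [coeffAdd, ofCoeffs]
  | cons a l ih =>
    cases m with
    | nil => simp [coeffAdd, ofCoeffs]
    | cons b m =>
      simp only [coeffAdd, ofCoeffs, ih, Int.cast_add]
      ring

theorem ofCoeffs_coeffScale (c : ℤ) (l : List ℤ) :
    ofCoeffs R (coeffScale c l) = (c : R[X]) * ofCoeffs R l := by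
  induction l with
  | nil => simp [coeffScale, ofCoeffs]
  | cons a l ih =>
    rw [coeffScale] at ih
    simp only [coeffScale, List.map_cons, ofCoeffs, ih, Int.cast_mul]
    ring

theorem ofCoeffs_coeffMul (l m : List ℤ) :
    ofCoeffs R (coeffMul l m) = ofCoeffs R l * ofCoeffs R m := by
  induction l with
  | nil => simp [coeffMul, ofCoeffs]
  | cons a l ih =>
    simp only [coeffMul, ofCoeffs, ofCoeffs_coeffAdd, ofCoeffs_coeffScale, ih, Int.cast_zero]
    ring

theorem ofCoeffs_coeffPow (l : List ℤ) (n : ℕ) :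
    ofCoeffs R (coeffPow l n) = ofCoeffs R l ^ n := by
  induction n with
  | zero => simp [coeffPow, ofCoeffs]
  | succ n ih => rw [coeffPow, ofCoeffs_coeffMul, ih, pow_succ']

theorem map_ofCoeffs {S : Type*} [CommRing S] (f : R →+* S) (l : List ℤ) :
    (ofCoeffs R l).map f = ofCoeffs S l := by
  induction l with
  | nil => simp [ofCoeffs]
  | cons a l ih => simp [ofCoeffs, ih]

theorem eval_ofCoeffs (t : ℤ) (l : List ℤ) :
    (ofCoeffs R l).eval (t : R) = (coeffEval t l : R) := by
  induction l with
  | nil => simp [ofCoeffs, coeffEval]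
  | cons a l ih => simp [ofCoeffs, coeffEval, ih]

theorem coeff_ofCoeffs (l : List ℤ) (n : ℕ) : (ofCoeffs R l).coeff n = (l.getD n 0 : R) := by
  induction l generalizing n with
  | nil => simp [ofCoeffs]
  | cons a l ih =>
    rw [ofCoeffs, coeff_add, ← map_intCast (C : R →+* R[X]) a]
    cases n with
    | zero => rw [coeff_C_zero, mul_coeff_zero, coeff_X_zero, zero_mul, add_zero]; rfl
    | succ n => rw [coeff_C_succ, coeff_X_mul, zero_add, ih]; rfl

theorem ofCoeffs_eq_of_forall_dvd (p : ℕ) [CharP R p] {l m : List ℤ}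
    (hlm : ∀ a ∈ coeffAdd l (coeffScale (-1) m), (p : ℤ) ∣ a) : ofCoeffs R l = ofCoeffs R m := by
  have h0 : ∀ l : List ℤ, (∀ a ∈ l, (p : ℤ) ∣ a) → ofCoeffs R l = 0 := by
    intro l hl
    induction l with
    | nil => rfl
    | cons a l ih =>
      rw [ofCoeffs, ih fun b hb ↦ hl b (List.mem_cons_of_mem a hb),
        ← map_intCast (C : R →+* R[X]) a, (CharP.intCast_eq_zero_iff R p a).2 (hl a List.mem_cons_self)]
      simp
  have h1 := h0 _ hlm
  rw [ofCoeffs_coeffAdd, ofCoeffs_coeffScale] at h1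
  simpa [sub_eq_add_neg, add_neg_eq_zero] using h1

theorem ofCoeffs_eq {l m : List ℤ} (hlm : ∀ a ∈ coeffAdd l (coeffScale (-1) m), a = 0) :
    ofCoeffs R l = ofCoeffs R m := by
  rw [← map_ofCoeffs (Int.castRingHom R) l, ← map_ofCoeffs (Int.castRingHom R) m]
  congr 1
  exact ofCoeffs_eq_of_forall_dvd 0 fun a ha ↦ by simp [hlm a ha]

theorem natDegree_ofCoeffs [CharZero R] {l : List ℤ} (n : ℕ) (h0 : l.getD n 0 ≠ 0)
    (h1 : ∀ a ∈ l.drop (n + 1), a = 0) : (ofCoeffs R l).natDegree = n := by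
  refine natDegree_eq_of_le_of_coeff_ne_zero (natDegree_le_iff_coeff_eq_zero.2 fun i hi ↦ ?_) ?_
  · rw [coeff_ofCoeffs, Int.cast_eq_zero]
    rcases lt_or_ge i l.length with h2 | h2
    · rw [List.getD_eq_getElem _ _ h2]
      apply h1
      rw [List.mem_drop_iff_getElem]
      exact ⟨i - (n + 1), by omega, by congr 1; omega⟩
    · exact List.getD_eq_default _ _ h2
  · rw [coeff_ofCoeffs]
    exact_mod_cast h0

end Lists

/-- Polynomials over `ℤ` that are coprime modulo a prime `p` are coprime over `ℚ` if `p` does not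
divide the leading coefficient of one of them: a primitive common factor would have the same
degree modulo `p`. -/
theorem isCoprime_map_of_isCoprime_mod {a b : ℤ[X]} (p : ℕ) [Fact p.Prime]
    (hp : ¬ (p : ℤ) ∣ a.leadingCoeff)
    (hab : IsCoprime (a.map (Int.castRingHom (ZMod p))) (b.map (Int.castRingHom (ZMod p)))) :
    IsCoprime (a.map (Int.castRingHom ℚ)) (b.map (Int.castRingHom ℚ)) := by
  have ha : a ≠ 0 := by
    rintro rfl
    simp at hp
  have hinj := (Int.castRingHom ℚ).injective_int
  have ha' : a.map (Int.castRingHom ℚ) ≠ 0 := (Polynomial.map_ne_zero_iff hinj).2 ha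
  refine isCoprime_of_irreducible_dvd (fun h0 ↦ ha' h0.1) fun d hd hda hdb ↦ ?_
  -- `e` is a primitive integral multiple of `d`
  set f := IsLocalization.integerNormalization (nonZeroDivisors ℤ) d
  obtain ⟨c, hc, hfc⟩ := IsLocalization.integerNormalization_spec (nonZeroDivisors ℤ) d
  have hc₀ : (c : ℚ) ≠ 0 := Int.cast_ne_zero.2 (nonZeroDivisors.ne_zero hc)
  have hfd : f.map (Int.castRingHom ℚ) = C (c : ℚ) * d := by
    rw [C_mul', Int.cast_smul_eq_zsmul]
    exact hfc
  have hf₀ : f ≠ 0 := by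
    intro h0
    rw [h0, Polynomial.map_zero] at hfd
    exact mul_ne_zero (C_ne_zero.2 hc₀) hd.ne_zero hfd.symm
  set e := f.primPart
  have he : e.IsPrimitive := f.isPrimitive_primPart
  have hdvd : ∀ q : ℤ[X], d ∣ q.map (Int.castRingHom ℚ) → e ∣ q := by
    intro q hq
    rw [IsPrimitive.Int.dvd_iff_map_cast_dvd_map_cast e q he]
    refine (Polynomial.map_dvd _ f.primPart_dvd).trans ?_
    rw [hfd, (isUnit_C.2 hc₀.isUnit).mul_left_dvd]
    exact hq
  have hdeg : e.natDegree = d.natDegree := by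
    rw [natDegree_primPart, ← natDegree_map_eq_of_injective hinj, hfd, natDegree_C_mul hc₀]
  have hunit := hab.isUnit_of_dvd' (Polynomial.map_dvd _ (hdvd a hda))
    (Polynomial.map_dvd _ (hdvd b hdb))
  have hlead : Int.castRingHom (ZMod p) e.leadingCoeff ≠ 0 := by
    rw [eq_intCast, Ne, ZMod.intCast_zmod_eq_zero_iff_dvd]
    exact fun h0 ↦ hp (h0.trans (leadingCoeff_dvd_leadingCoeff (hdvd a hda)))
  have h1 := natDegree_eq_zero_of_isUnit hunit
  rw [natDegree_map_of_leadingCoeff_ne_zero _ hlead, hdeg] at h1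
  exact hd.natDegree_pos.ne' h1

theorem isCoprime_ofCoeffs (p : ℕ) [Fact p.Prime] {l m a b : List ℤ} (n : ℕ)
    (hl : ¬ (p : ℤ) ∣ l.getD n 0) (hl' : ∀ c ∈ l.drop (n + 1), c = 0)
    (h1 : ∀ c ∈ coeffAdd (coeffAdd (coeffMul a l) (coeffMul b m)) (coeffScale (-1) [1]),
      (p : ℤ) ∣ c) :
    IsCoprime (ofCoeffs ℚ l) (ofCoeffs ℚ m) := by
  rw [← map_ofCoeffs (Int.castRingHom ℚ) l, ← map_ofCoeffs (Int.castRingHom ℚ) m]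
  apply isCoprime_map_of_isCoprime_mod p
  · have h0 : l.getD n 0 ≠ 0 := fun h0 ↦ hl (by rw [h0]; exact dvd_zero _)
    rw [leadingCoeff, natDegree_ofCoeffs n h0 hl', coeff_ofCoeffs]
    exact hl
  · rw [map_ofCoeffs, map_ofCoeffs]
    refine ⟨ofCoeffs (ZMod p) a, ofCoeffs (ZMod p) b, ?_⟩
    rw [← ofCoeffs_coeffMul, ← ofCoeffs_coeffMul, ← ofCoeffs_coeffAdd,
      ofCoeffs_eq_of_forall_dvd p h1]
    simp [ofCoeffs]

/-! ### The parametric solution -/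

def coeffA : List ℤ := [-1, 0, 0, 3]

def coeffB : List ℤ := [1, 3, 9, 9, 9]

def coeffC : List ℤ := [-1, 3, -9, 18, 0, 0, -81, 81]

def coeffD : List ℤ := [2, 3, 9, 0, -9, -54, 0, 0, 81]

def coeffE : List ℤ := [1, 3, 0, -9, -45, -27, 0, 81, 81]

def coeffF : List ℤ := [2, 3, 10, 3, -9, -63, -45, -27, 81, 81, 81]

def coeffG : List ℤ := [1, 3, 0, -9, -27, 0, 81, 81, 0, -486, 0, 0, 729]

def coeffH : List ℤ := [1, 3, 18, 72, 288, 675, 1215, 567, -1701, -7047, -9477, -8019, 3645,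
  13122, 19683, 13122, 6561]

def coeffI : List ℤ := [-1, -3, -27, -153, -864, -3024, -8748, -14904, -13284, 37179, 148716,
  334611, 325863, -48114, -1226907, -2322594, -2768742, -98415, 4192479, 9506889, 8562105,
  1948617, -10628820, -16474671, -12754584, 0, 9565938, 9565938, 4782969]

def coeffz₂ : List ℤ := [1, 0, 18, 36, 342, 1026, 2349, 810, -8748, -30375, -44469, 8019, 134865,
  284310, 131220, -255879, -800442, -551124, 177147, 1062882, 885735, 0, -531441, -531441]

theorem polyA_eq : polyA = ofCoeffs ℚ coeffA := by
  simp [polyA, ofCoeffs, coeffA]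
  ring

theorem polyB_eq : polyB = ofCoeffs ℚ coeffB := by
  simp [polyB, ofCoeffs, coeffB]
  ring

theorem polyC_eq : polyC = ofCoeffs ℚ coeffC := by
  simp [polyC, ofCoeffs, coeffC]
  ring

theorem polyD_eq : polyD = ofCoeffs ℚ coeffD := by
  simp [polyD, ofCoeffs, coeffD]
  ring

theorem polyE_eq : polyE = ofCoeffs ℚ coeffE := by
  simp [polyE, ofCoeffs, coeffE]
  ring

theorem polyF_eq : polyF = ofCoeffs ℚ coeffF := by
  simp [polyF, ofCoeffs, coeffF]
  ring

theorem polyG_eq : polyG = ofCoeffs ℚ coeffG := by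
  simp [polyG, ofCoeffs, coeffG]
  ring

theorem polyH_eq : polyH = ofCoeffs ℚ coeffH := by
  simp [polyH, ofCoeffs, coeffH]
  ring

theorem polyI_eq : polyI = ofCoeffs ℚ coeffI := by
  simp [polyI, ofCoeffs, coeffI]
  ring

theorem z₂_eq : z₂ = ofCoeffs ℚ coeffz₂ := by
  simp [z₂, ofCoeffs, coeffz₂]
  ring

def coeffx₀ : List ℤ := coeffMul [0, 0, 9] (coeffMul (coeffPow coeffA 2) (coeffMul coeffD coeffE))

def coeffy₀ : List ℤ := coeffMul [0, 0, 9] (coeffMul coeffF coeffG)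

def coeffz₀ : List ℤ := coeffMul coeffC coeffH

/-- The numerator of `x₁`. -/
def numx₁ : ℚ[X] := 3 * X * polyA * polyD * polyH

/-- The coefficients of `numx₁`. -/
def coeffx₁ : List ℤ := coeffMul [0, 3] (coeffMul coeffA (coeffMul coeffD coeffH))

def coeffz₁ : List ℤ := coeffMul [0, 3] (coeffMul coeffA (coeffMul coeffB (coeffMul coeffC coeffE)))

def coeffx₂ : List ℤ := coeffMul [0, 0, 0, -27] (coeffMul coeffA (coeffMul coeffD coeffF))

def coeffy₂ : List ℤ := coeffMul [0, -3] (coeffMul coeffA (coeffMul coeffE coeffG))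

theorem x₀_eq : x₀ = ofCoeffs ℚ coeffx₀ := by
  simp [x₀, coeffx₀, ofCoeffs_coeffMul, polyA_eq, polyD_eq, polyE_eq, ofCoeffs_coeffPow, ofCoeffs]
  ring

theorem y₀_eq : y₀ = ofCoeffs ℚ coeffy₀ := by
  simp [y₀, coeffy₀, ofCoeffs_coeffMul, polyF_eq, polyG_eq, ofCoeffs]
  ring

theorem z₀_eq : z₀ = ofCoeffs ℚ coeffz₀ := by
  simp [z₀, coeffz₀, ofCoeffs_coeffMul, polyC_eq, polyH_eq]

theorem numx₁_eq : numx₁ = ofCoeffs ℚ coeffx₁ := by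
  simp [numx₁, coeffx₁, ofCoeffs_coeffMul, polyA_eq, polyD_eq, polyH_eq, ofCoeffs]
  ring

theorem z₁_eq : z₁ = ofCoeffs ℚ coeffz₁ := by
  simp [z₁, coeffz₁, ofCoeffs_coeffMul, polyA_eq, polyB_eq, polyC_eq, polyE_eq, ofCoeffs]
  ring

theorem x₂_eq : x₂ = ofCoeffs ℚ coeffx₂ := by
  simp [x₂, coeffx₂, ofCoeffs_coeffMul, polyA_eq, polyD_eq, polyF_eq, ofCoeffs]
  ring

theorem y₂_eq : y₂ = ofCoeffs ℚ coeffy₂ := by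
  simp [y₂, coeffy₂, ofCoeffs_coeffMul, polyA_eq, polyE_eq, polyG_eq, ofCoeffs]
  ring

theorem rat_polyB_ne_zero : rat polyB ≠ 0 := by
  refine (map_ne_zero_iff _ (IsFractionRing.injective ℚ[X] (RatFunc ℚ))).2 fun h0 ↦ ?_
  have := congrArg (eval 0) h0
  simp [polyB] at this

theorem numx₁_mul_z₁ : numx₁ * z₁ = x₀ * z₀ * polyB := by
  rw [numx₁, z₁, x₀, z₀]
  ring

theorem x₂_mul_y₂ : x₂ * y₂ = x₀ * y₀ := by
  rw [x₂, y₂, x₀, y₀]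
  ring

theorem numx₁_cube_sub : numx₁ ^ 3 - polyI ^ 3 + (polyB * z₁) ^ 3 =
    -(polyB ^ 3 * (x₀ ^ 3 - y₀ ^ 3 + z₀ ^ 3)) := by
  have := ofCoeffs_eq (R := ℚ)
    (l := coeffAdd (coeffAdd (coeffPow coeffx₁ 3) (coeffScale (-1) (coeffPow coeffI 3)))
      (coeffPow (coeffMul coeffB coeffz₁) 3))
    (m := coeffScale (-1) (coeffMul (coeffPow coeffB 3) (coeffAdd (coeffAdd (coeffPow coeffx₀ 3)
      (coeffScale (-1) (coeffPow coeffy₀ 3))) (coeffPow coeffz₀ 3)))) (by decide +kernel)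
  simp only [ofCoeffs_coeffAdd, ofCoeffs_coeffMul, ofCoeffs_coeffPow, ofCoeffs_coeffScale,
    ← numx₁_eq, ← polyI_eq, ← polyB_eq, ← x₀_eq, ← y₀_eq, ← z₀_eq, ← z₁_eq] at this
  push_cast at this
  linear_combination this

theorem x₂_cube_add : x₂ ^ 3 + y₂ ^ 3 - z₂ ^ 3 = -(x₀ ^ 3 + y₀ ^ 3 - z₀ ^ 3) := by
  have := ofCoeffs_eq (R := ℚ)
    (l := coeffAdd (coeffAdd (coeffPow coeffx₂ 3) (coeffPow coeffy₂ 3))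
      (coeffScale (-1) (coeffPow coeffz₂ 3)))
    (m := coeffScale (-1) (coeffAdd (coeffAdd (coeffPow coeffx₀ 3)
      (coeffPow coeffy₀ 3)) (coeffScale (-1) (coeffPow coeffz₀ 3)))) (by decide +kernel)
  simp only [ofCoeffs_coeffAdd, ofCoeffs_coeffPow, ofCoeffs_coeffScale,
    ← x₂_eq, ← y₂_eq, ← z₂_eq, ← x₀_eq, ← y₀_eq, ← z₀_eq] at this
  push_cast at this
  linear_combination this

theorem x₁_mul_z₁ : x₁ * rat z₁ = rat (x₀ * z₀) := by
  rw [x₁, ← numx₁, div_mul_eq_mul_div, div_eq_iff rat_polyB_ne_zero, rat, rat, ← map_mul,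
    numx₁_mul_z₁, map_mul]

theorem x₁_cube_sub : x₁ ^ 3 - y₁ ^ 3 + rat z₁ ^ 3 = rat (-(x₀ ^ 3 - y₀ ^ 3 + z₀ ^ 3)) := by
  have hB := rat_polyB_ne_zero
  have key := congrArg rat numx₁_cube_sub
  simp only [rat, map_neg, map_sub, map_add, map_mul, map_pow] at key hB ⊢
  rw [x₁, y₁, ← numx₁]
  field_simp
  linear_combination key

/-- The coefficients of `h`, from `h = (x₀ ^ 3 - y₀ ^ 3 + z₀ ^ 3) ^ 2 - 4 (x₀ z₀) ^ 3`. -/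
def coeffh : List ℤ :=
  coeffAdd (coeffPow (coeffAdd (coeffAdd (coeffPow coeffx₀ 3) (coeffScale (-1) (coeffPow coeffy₀ 3)))
    (coeffPow coeffz₀ 3)) 2) (coeffScale (-4) (coeffPow (coeffMul coeffx₀ coeffz₀) 3))

theorem h_eq : h = ofCoeffs ℚ coeffh := by
  simp only [coeffh, ofCoeffs_coeffAdd, ofCoeffs_coeffMul, ofCoeffs_coeffPow, ofCoeffs_coeffScale,
    ← x₀_eq, ← y₀_eq, ← z₀_eq, h, form]
  push_cast
  ring

theorem natDegree_h : h.natDegree = 141 := by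
  rw [h_eq]
  exact natDegree_ofCoeffs 141 (by decide +kernel) (by decide +kernel)

/-! ### The four functions -/

/-- `g i` is `(W Y + U) / W` with `W = polyV i ^ 3`, where `polyV i` is a denominator. -/
def polyV : Fin 4 → ℚ[X] := ![1, 1, polyB, 1]

/-- The rational part of `polyV i ^ 3 * g i`. -/
def polyU : Fin 4 → ℚ[X] :=
  ![x₀ ^ 3 + y₀ ^ 3 - z₀ ^ 3, x₀ ^ 3 - y₀ ^ 3 + z₀ ^ 3,
    numx₁ ^ 3 + polyI ^ 3 - (polyB * z₁) ^ 3, -x₂ ^ 3 + y₂ ^ 3 + z₂ ^ 3]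

/-- The norm of `polyV i ^ 3 * g i` to `ℚ(t)` is `4 * polyN i ^ 3`. -/
def polyN : Fin 4 → ℚ[X] := ![x₀ * y₀, x₀ * z₀, numx₁ * polyI, y₂ * z₂]

/-- The coefficients of `polyV`. -/
def coeffV : Fin 4 → List ℤ := ![[1], [1], coeffB, [1]]

/-- The coefficients of `polyU`. -/
def coeffU : Fin 4 → List ℤ :=
  ![coeffAdd (coeffAdd (coeffPow coeffx₀ 3) (coeffPow coeffy₀ 3))
      (coeffScale (-1) (coeffPow coeffz₀ 3)),
    coeffAdd (coeffAdd (coeffPow coeffx₀ 3) (coeffScale (-1) (coeffPow coeffy₀ 3)))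
      (coeffPow coeffz₀ 3),
    coeffAdd (coeffAdd (coeffPow coeffx₁ 3) (coeffPow coeffI 3))
      (coeffScale (-1) (coeffPow (coeffMul coeffB coeffz₁) 3)),
    coeffAdd (coeffAdd (coeffScale (-1) (coeffPow coeffx₂ 3)) (coeffPow coeffy₂ 3))
      (coeffPow coeffz₂ 3)]

/-- The coefficients of `polyN`. -/
def coeffN : Fin 4 → List ℤ :=
  ![coeffMul coeffx₀ coeffy₀, coeffMul coeffx₀ coeffz₀, coeffMul coeffx₁ coeffI,
    coeffMul coeffy₂ coeffz₂]

theorem polyV_eq (i : Fin 4) : polyV i = ofCoeffs ℚ (coeffV i) := by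
  have h1 : ofCoeffs ℚ [1] = 1 := by simp [ofCoeffs]
  fin_cases i <;> simp [polyV, coeffV, h1, polyB_eq]

theorem polyU_eq (i : Fin 4) : polyU i = ofCoeffs ℚ (coeffU i) := by
  fin_cases i <;> simp [polyU, coeffU, ofCoeffs_coeffAdd, ofCoeffs_coeffMul, ofCoeffs_coeffPow,
    ofCoeffs_coeffScale, polyB_eq, polyI_eq, x₀_eq, y₀_eq, z₀_eq, numx₁_eq, z₁_eq, x₂_eq, y₂_eq,
    z₂_eq, sub_eq_add_neg]

theorem polyN_eq (i : Fin 4) : polyN i = ofCoeffs ℚ (coeffN i) := by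
  fin_cases i <;> simp [polyN, coeffN, ofCoeffs_coeffMul, polyI_eq, x₀_eq, y₀_eq, z₀_eq, numx₁_eq,
    y₂_eq, z₂_eq]

theorem polyV_ne_zero (i : Fin 4) : polyV i ≠ 0 := by
  have hB : polyB ≠ 0 := fun h0 ↦ rat_polyB_ne_zero (by rw [h0, rat, map_zero])
  fin_cases i <;> simp [polyV, hB]

theorem ofPoly_polyV_ne_zero (i : Fin 4) : ofPoly (polyV i) ≠ 0 :=
  ofPoly_ne_zero (polyV_ne_zero i)

theorem ofPoly_mul_g (i : Fin 4) :
    ofPoly (polyV i) ^ 3 * g i = ofPoly (polyV i ^ 3) * Y + ofPoly (polyU i) := by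
  rw [map_pow]
  fin_cases i
  · simp [polyV, polyU, g, ofPoly_apply]
  · simp [polyV, polyU, g, ofPoly_apply]
  · have h1 : rat polyB ^ 3 * (x₁ ^ 3 + y₁ ^ 3 - rat z₁ ^ 3) =
        rat (numx₁ ^ 3 + polyI ^ 3 - (polyB * z₁) ^ 3) := by
      have hB := rat_polyB_ne_zero
      rw [x₁, y₁, ← numx₁]
      simp only [rat, map_add, map_sub, map_mul, map_pow] at hB ⊢
      field_simp
    change onC (rat polyB) ^ 3 * (Y + onC _) = onC (rat polyB) ^ 3 * Y +
      onC (rat (numx₁ ^ 3 + polyI ^ 3 - (polyB * z₁) ^ 3))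
    rw [← h1, mul_add, onC_mul, onC_pow]
  · simp [polyV, polyU, g, ofPoly_apply]

theorem polyU_sq_sub (i : Fin 4) :
    polyU i ^ 2 - (polyV i ^ 3) ^ 2 * h = 4 * polyN i ^ 3 := by
  rw [h, form]
  fin_cases i
  · simp [polyU, polyV, polyN]
    ring
  · simp [polyU, polyV, polyN]
    ring
  · have e3 := congrArg (· ^ 3) numx₁_mul_z₁
    simp [polyU, polyV, polyN] at e3 ⊢
    linear_combination (numx₁ ^ 3 - polyI ^ 3 + (polyB * z₁) ^ 3 -
      polyB ^ 3 * (x₀ ^ 3 - y₀ ^ 3 + z₀ ^ 3)) * numx₁_cube_sub - 4 * polyB ^ 3 * e3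
  · have e3 := congrArg (· ^ 3) x₂_mul_y₂
    simp [polyU, polyV, polyN] at e3 ⊢
    linear_combination (x₂ ^ 3 + y₂ ^ 3 - z₂ ^ 3 - (x₀ ^ 3 + y₀ ^ 3 - z₀ ^ 3)) * x₂_cube_add
      - 4 * e3

/-- The `a` in Bézout relations `a * polyN i + b * polyU i = 1` modulo `7`. -/
def bezoutN : Fin 4 → List ℤ :=
  ![[-1, -3, -3, -3, 3, -3, 1, -1, 3, -2, 0, 0, -1, -1, 3, 3, -1, -1, 2, 1, -2, -3, 3, 3, 1, 1,
    3, -2, -3, 2, 3, -2, -2, -3, 1, 0, -1, 2, -3, -3, 3, -1, -2, 0, 3, 0, -3, -2, -1, 2, -3, 3,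
    0, 2, 1, -3, 2, 3, -2, 2, -2, 1, 2, 2, 0, -1, -1, 2, -1, 3, -3, 1], [1, 3, -2, 1, 1, -3, -1,
    -3, 1, 1, 2, -2, 0, 1, 0, 3, -1, 1, 0, -3, 2, -3, 0, 1, 0, 1, 2, 0, 1, 1, 3, 3, 3, -1, 2, 3,
    1, -1, 2, 1, -1, 3, -2, 2, -1, -1, 1, 1, 2, -3, 2, 2, 1, 1, 1, 0, 3, 0, 3, -1, -2, -3, -1,
    -3, -2, 3, 2, 1, 3, 2], [-3, 2, 0, 1, -1, 0, -2, 2, -3, 1, -2, -2, -3, 1, 0, 2, 0, -1, 0, 0,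
    -1, 3, 3, -1, -1, -3, -2, -2, 1, 0, -3, 0, -1, 2, -1, -3, 2, -3, -1, 0, 1, -2, 0, -1, 2, -2,
    1, 1, -3, -3, -2, 0, -3, -2, -3, -2, 0, 1, 2, 2, -3, 3, 0, 1, 0, 1, -3, 2, 0, 2, 2, 3, 0, 0,
    -3, 1, -3, 2, 3, 0, 0, -2, 2], [-1, -1, 3, 0, 3, 1, -2, 2, 0, 1, -1, 1, -1, 0, -3, 0, 0, 2,
    3, 2, 1, -1, -1, -2, 1, 2, 1, 0, 0, 0, -2, 3, 3, -2, -2, 2, -2, 1, -3, 2, -3, 1, -1, 2, -2,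
    -2, -2, -3, -3, 0, 0, 0, 3, 2, 3, 3, 2, 0, -2, -2, 1, 2, -1, -3, -2, -1, -2, 2, -1, 2]]

/-- The `b` in Bézout relations `a * polyN i + b * polyU i = 1` modulo `7`. -/
def bezoutU : Fin 4 → List ℤ :=
  ![[1, 0, 2, 3, -1, -2, 1, -2, 2, 3, 3, 1, 1, 2, -2, -3, 1, 0, 0, 2, -3, 2, 1, -3, 2, -2, 0, 1,
    3, 1, -3, -3, 0, -2, 0, 1, -3, -3, 1, 2, 3, 1, 1, 2, 3, 2, 2, 3], [-1, 0, 1, 2, 2, -1, -1,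
    -1, -1, 3, -3, 0, -2, 2, -1, 3, 3, 0, 0, -2, 0, -3, 2, 3, -2, 2, 0, -2, -1, -2, 3, -1, -1,
    -2, 2, 1, -2, -2, -2, 0, 2, -2, -2, -3, -1, 0, 3], [-1, -2, 3, -1, 2, -2, 1, -3, -3, -2, -2,
    1, 2, -2, 2, -3, 3, -1, 1, -3, 3, -3, 1, 0, -1, -1, 3, -2, 2, 3, -2, 1, 2, -2, -1, 3, 1, -2,
    0, -2, 0, -2, 0, 3, 3, 3, -2, -2, 3, 3, 2, -2, 0, -2, 3], [1, 3, 2, 3, 3, 3, -1, 0, 3, 1, 3,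
    -1, 3, -1, 3, -3, 3, -3, 1, 0, 3, 0, 1, 3, 2, 3, -2, -2, -1, 1, 3, -1, 1, -2, 0, 0, 3, 0,
    -2, -1, 1, 0, 1, -3, 0, -3, -3]]

theorem isCoprime_polyN_polyU (i : Fin 4) : IsCoprime (polyN i) (polyU i) := by
  have : Fact (Nat.Prime 7) := ⟨by norm_num⟩
  have hB : ∀ i, ∀ c ∈ coeffAdd (coeffAdd (coeffMul (bezoutN i) (coeffN i))
      (coeffMul (bezoutU i) (coeffU i))) (coeffScale (-1) [1]), ((7 : ℕ) : ℤ) ∣ c := by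
    decide +kernel
  have h1 : ∀ i, ¬ ((7 : ℕ) : ℤ) ∣ (coeffN i).getD ((![48, 47, 56, 47] : Fin 4 → ℕ) i) 0 := by
    decide +kernel
  have h2 : ∀ i, ∀ c ∈ (coeffN i).drop ((![48, 47, 56, 47] : Fin 4 → ℕ) i + 1), c = 0 := by
    decide +kernel
  rw [polyN_eq, polyU_eq]
  exact isCoprime_ofCoeffs 7 _ (h1 i) (h2 i) (hB i)

theorem polyN_ne_zero (i : Fin 4) : polyN i ≠ 0 := by
  intro h0
  have h1 : ∀ i, coeffEval 1 (coeffN i) ≠ 0 := by decide +kernel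
  have := congrArg (eval ((1 : ℤ) : ℚ)) h0
  rw [polyN_eq, eval_ofCoeffs, eval_zero, Int.cast_eq_zero] at this
  exact h1 i this

theorem odd_natDegree_h : Odd h.natDegree := by
  rw [natDegree_h]
  decide

theorem g_ne_zero (i : Fin 4) : g i ≠ 0 := by
  intro h0
  have := ofPoly_mul_Y_add_ne_zero (U := polyU i) (pow_ne_zero 3 (polyV_ne_zero i))
  rw [← ofPoly_mul_g, h0, mul_zero] at this
  exact this rfl

theorem three_dvd_ord_g (i : Fin 4) (v : Place ℚ FunField) : 3 ∣ v.ord (g i) := by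
  have h1 := three_dvd_ord v odd_natDegree_h (pow_ne_zero 3 (polyV_ne_zero i)) (polyN_ne_zero i)
    (polyU_sq_sub i) (isCoprime_polyN_polyU i)
  rw [← ofPoly_mul_g, v.ord_mul (pow_ne_zero 3 (ofPoly_polyV_ne_zero i)) (g_ne_zero i),
    v.ord_pow] at h1
  push_cast at h1
  omega

/-! ### Cubes in the function field and their values at points over finite fields -/

/-- Polynomials in `t` with integral coefficients, as functions on the curve. -/
def ofIntPoly : ℤ[X] →+* FunField := ofPoly.comp (mapRingHom (Int.castRingHom ℚ))

theorem ofIntPoly_apply (p : ℤ[X]) : ofIntPoly p = ofPoly (p.map (Int.castRingHom ℚ)) := rfl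

theorem ofIntPoly_injective : Function.Injective ofIntPoly :=
  ofPoly_injective.comp (map_injective _ (Int.castRingHom ℚ).injective_int)

/-- An equation `Y ^ 2 = h(t)` with integral coefficients. -/
def intPolyh : ℤ[X] := ofCoeffs ℤ coeffh

theorem ofIntPoly_intPolyh : ofIntPoly intPolyh = Y ^ 2 := by
  rw [ofIntPoly_apply, intPolyh, map_ofCoeffs, ← h_eq, Y_sq_eq_ofPoly]

theorem conj_ofIntPoly (p : ℤ[X]) : conj (ofIntPoly p) = ofIntPoly p := conj_ofPoly _

/-- `ℤ[t]` is integrally closed in `ℚ(t)`. -/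
theorem exists_eq_of_isIntegralElem_onC {r : RatFunc ℚ}
    (hr : ofIntPoly.IsIntegralElem (onC r)) : ∃ p : ℤ[X], onC r = ofIntPoly p := by
  obtain ⟨P, hP, hPr⟩ := hr
  have hr' : IsIntegral ℚ[X] r := by
    refine ⟨P.map (mapRingHom (Int.castRingHom ℚ)), hP.map _, onC_injective ?_⟩
    rw [eval₂_map]
    change algebraMap (RatFunc ℚ) FunField _ = algebraMap (RatFunc ℚ) FunField 0
    rw [hom_eval₂, map_zero]
    exact hPr
  obtain ⟨q, rfl⟩ := IsIntegrallyClosed.isIntegral_iff.1 hr'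
  let _ : Algebra ℤ[X] ℚ[X] := Polynomial.algebra ℤ ℚ
  have hq : IsIntegral ℤ[X] q := by
    refine ⟨P, hP, ofPoly_injective ?_⟩
    rw [hom_eval₂, map_zero]
    exact hPr
  rw [isIntegral_iff_isIntegral_coeff] at hq
  have hq' : q ∈ lifts (Int.castRingHom ℚ) := by
    rw [lifts_iff_coeff_lifts]
    intro n
    obtain ⟨c, hc⟩ := IsIntegrallyClosed.isIntegral_iff.1 (hq n)
    exact ⟨c, hc⟩
  obtain ⟨p, rfl⟩ := (mem_lifts _).1 hq'
  exact ⟨p, rfl⟩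

theorem isIntegralElem_conj {F : FunField} (hF : ofIntPoly.IsIntegralElem F) :
    ofIntPoly.IsIntegralElem (conj F) := by
  obtain ⟨P, hP, hPF⟩ := hF
  refine ⟨P, hP, ?_⟩
  have h1 := congrArg conj hPF
  rw [hom_eval₂, map_zero] at h1
  rwa [show conj.comp ofIntPoly = ofIntPoly from RingHom.ext conj_ofIntPoly] at h1

theorem isIntegralElem_Y : ofIntPoly.IsIntegralElem Y := by
  refine ⟨X ^ 2 - C intPolyh, monic_X_pow_sub_C _ two_ne_zero, ?_⟩
  rw [eval₂_sub, eval₂_pow, eval₂_X, eval₂_C, ofIntPoly_intPolyh, sub_self]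

/-- A function that is integral over `ℤ[t]` lies in `ℤ[t, Y]` after multiplication by `2 h`, by
the integrality of the traces of `F` and `F Y`. -/
theorem exists_two_mul_h_mul_eq {F : FunField} (hF : ofIntPoly.IsIntegralElem F) :
    ∃ P Q : ℤ[X], ofIntPoly (2 * intPolyh) * F = ofIntPoly P + ofIntPoly Q * Y := by
  obtain ⟨a, b, rfl⟩ := exists_eq_onC_add F
  have h1 : ofIntPoly.IsIntegralElem (onC (2 * a)) := by
    have := hF.add _ (isIntegralElem_conj hF)
    rwa [map_add, map_mul, conj_onC, conj_onC, conj_Y, show onC a + onC b * Y +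
      (onC a + onC b * -Y) = 2 * onC a by ring, ← map_ofNat (algebraMap (RatFunc ℚ) FunField) 2,
      ← map_mul] at this
  have h2 : ofIntPoly.IsIntegralElem (onC (2 * b * rat h)) := by
    have hFY := hF.mul _ isIntegralElem_Y
    have := hFY.add _ (isIntegralElem_conj hFY)
    rwa [map_mul, map_add, map_mul, conj_onC, conj_onC, conj_Y, show (onC a + onC b * Y) * Y +
      (onC a + onC b * -Y) * -Y = 2 * onC b * Y ^ 2 by ring, Y_sq,
      ← map_ofNat (algebraMap (RatFunc ℚ) FunField) 2, ← map_mul, ← map_mul] at this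
  obtain ⟨P, hP⟩ := exists_eq_of_isIntegralElem_onC h1
  obtain ⟨Q, hQ⟩ := exists_eq_of_isIntegralElem_onC h2
  refine ⟨intPolyh * P, Q, ?_⟩
  rw [map_mul, map_mul, ← hP, ← hQ, ofIntPoly_intPolyh, Y_sq, map_ofNat]
  simp only [onC, map_mul, map_ofNat]
  ring

/-- The function on the curve given by a polynomial in `t` and `Y` over `ℤ`. -/
def evalY : ℤ[X][X] →+* FunField := eval₂RingHom ofIntPoly Y

/-- The value of a polynomial in `t` and `Y` at a point of the plane over `R`. -/
def evalAt {R : Type*} [CommRing R] (t y : R) : ℤ[X][X] →+* R :=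
  eval₂RingHom (eval₂RingHom (Int.castRingHom R) t) y

theorem isIntegralElem_evalY (q : ℤ[X][X]) : ofIntPoly.IsIntegralElem (evalY q) := by
  induction q using Polynomial.induction_on' with
  | add p q hp hq => rw [map_add]; exact hp.add _ hq
  | monomial n a =>
    have hY : ∀ n : ℕ, ofIntPoly.IsIntegralElem (Y ^ n) := by
      intro n
      induction n with
      | zero => simpa only [pow_zero] using ofIntPoly.isIntegralElem_one
      | succ n ih => simpa only [pow_succ] using ih.mul _ isIntegralElem_Y
    rw [evalY, coe_eval₂RingHom, eval₂_monomial]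
    exact (ofIntPoly.isIntegralElem_map).mul _ (hY n)

/-- Polynomial relations between `t` and `Y` hold at all points of the curve. -/
theorem evalAt_eq_zero {R : Type*} [CommRing R] {t y : R}
    (hty : y ^ 2 = eval₂ (Int.castRingHom R) t intPolyh) {q : ℤ[X][X]} (hq : evalY q = 0) :
    evalAt t y q = 0 := by
  have hm : (X ^ 2 - C intPolyh : ℤ[X][X]).Monic := monic_X_pow_sub_C _ two_ne_zero
  set r := q %ₘ (X ^ 2 - C intPolyh) with hr
  have hqr : q = r + (X ^ 2 - C intPolyh) * (q /ₘ (X ^ 2 - C intPolyh)) :=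
    (modByMonic_add_div q _).symm
  have h0 : evalY (X ^ 2 - C intPolyh) = 0 := by
    simp [evalY, ofIntPoly_intPolyh]
  have h0' : evalAt t y (X ^ 2 - C intPolyh) = 0 := by
    simp [evalAt, hty]
  have hdeg : r.natDegree ≤ 1 := by
    have := natDegree_modByMonic_lt q hm (fun h1 ↦ by
      have := congrArg natDegree h1
      rw [natDegree_X_pow_sub_C, natDegree_one] at this
      omega)
    rw [natDegree_X_pow_sub_C, ← hr] at this
    omega
  have h1 := eq_X_add_C_of_natDegree_le_one hdeg
  rw [hqr, map_add, map_mul, h0, zero_mul, add_zero, h1] at hq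
  have hq' : onC (rat ((r.coeff 0).map (Int.castRingHom ℚ))) +
      onC (rat ((r.coeff 1).map (Int.castRingHom ℚ))) * Y = 0 := by
    rw [← hq, add_comm]
    simp [evalY, ofIntPoly_apply, ofPoly_apply]
  obtain ⟨h2, h3⟩ := eq_zero_of_onC_add_eq_zero hq'
  have hz : ∀ p : ℤ[X], rat (p.map (Int.castRingHom ℚ)) = 0 → p = 0 := fun p hp ↦
    ofIntPoly_injective (by rw [map_zero, ofIntPoly_apply, ofPoly_apply, hp, onC, map_zero])
  have hr0 : r = 0 := by rw [h1, hz _ h2, hz _ h3]; simp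
  rw [hqr, map_add, map_mul, h0', zero_mul, add_zero, hr0, map_zero]

/-- If a polynomial in `t` and `Y` over `ℤ` is a cube in the function field, then its values at
the points of the curve modulo a prime are cubes, up to the factor `(2 h) ^ 3`. -/
theorem exists_cube_eq_evalAt {q : ℤ[X][X]} {F : FunField} (hF : evalY q = F ^ 3)
    {R : Type*} [CommRing R] {t y : R} (hty : y ^ 2 = eval₂ (Int.castRingHom R) t intPolyh) :
    ∃ z : R, z ^ 3 = (2 * y ^ 2) ^ 3 * evalAt t y q := by
  have hint : ofIntPoly.IsIntegralElem F := by
    obtain ⟨P, hP, hPF⟩ := isIntegralElem_evalY q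
    refine ⟨P.comp (X ^ 3), hP.comp (monic_X_pow 3) (by simp), ?_⟩
    rw [eval₂_comp, eval₂_pow, eval₂_X, ← hF]
    exact hPF
  obtain ⟨P, Q, hPQ⟩ := exists_two_mul_h_mul_eq hint
  have h1 : evalY ((C P + C Q * X) ^ 3 - (C (2 * intPolyh)) ^ 3 * q) = 0 := by
    rw [map_sub, map_pow, map_mul, map_pow, hF]
    simp only [evalY, coe_eval₂RingHom, eval₂_add, eval₂_mul, eval₂_C, eval₂_X]
    rw [← hPQ]
    ring
  have h2 := evalAt_eq_zero hty h1
  refine ⟨evalAt t y (C P + C Q * X), ?_⟩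
  rw [map_sub, map_pow, map_mul, map_pow, sub_eq_zero] at h2
  rw [h2, hty]
  simp [evalAt]

/-! ### Independence modulo cubes -/

theorem rat_mul (p q : ℚ[X]) : rat (p * q) = rat p * rat q := map_mul _ _ _

theorem rat_pow (p : ℚ[X]) (n : ℕ) : rat (p ^ n) = rat p ^ n := map_pow _ _ _

/-- The function `polyV i ^ 3 * g i` as a polynomial in `t` and `Y`. -/
def intPolyg (i : Fin 4) : ℤ[X][X] :=
  C (ofCoeffs ℤ (coeffV i) ^ 3) * X + C (ofCoeffs ℤ (coeffU i))

theorem evalY_intPolyg (i : Fin 4) : evalY (intPolyg i) = ofPoly (polyV i) ^ 3 * g i := by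
  rw [ofPoly_mul_g, polyV_eq, polyU_eq]
  simp only [evalY, intPolyg, coe_eval₂RingHom, eval₂_add, eval₂_mul, eval₂_C, eval₂_X,
    ofIntPoly_apply, Polynomial.map_pow, map_ofCoeffs]

theorem intPolyg_mul_conj (i : Fin 4) :
    evalY (intPolyg i) * conj (evalY (intPolyg i)) = ofPoly (4 * polyN i ^ 3) := by
  rw [evalY_intPolyg, ofPoly_mul_g, ← mul_conj_eq (polyU_sq_sub i), map_add, map_mul, conj_ofPoly,
    conj_ofPoly, conj_Y, map_neg, neg_mul, mul_neg]

/-- The norm to `ℚ(t)` determines the constant `c`, up to cubes, when `c` times a cube is a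
product of the four functions. -/
theorem exists_eq_cube_of_eq_mul_cube {r : Fin 4 → ℕ} {c : ℚ} {F : FunField}
    (hF : ∏ i, evalY (intPolyg i) ^ r i = algebraMap ℚ FunField c * F ^ 3) :
    ∃ F' : FunField, evalY (∏ i, (4 * intPolyg i) ^ r i) = F' ^ 3 := by
  set M := ∏ i, polyN i ^ r i with hM
  have hM0 : rat M ≠ 0 := fun h0 ↦ Finset.prod_ne_zero_iff.2
    (fun i _ ↦ pow_ne_zero (r i) (polyN_ne_zero i))
    (IsFractionRing.injective ℚ[X] (RatFunc ℚ) (h0.trans (map_zero _).symm))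
  obtain ⟨a, b, hab⟩ := exists_eq_onC_add F
  have hnorm : F * conj F = onC (a ^ 2 - b ^ 2 * rat h) := by
    rw [hab, map_add, map_mul, conj_onC, conj_onC, conj_Y]
    simp only [onC, map_sub, map_mul, map_pow]
    linear_combination (-(algebraMap (RatFunc ℚ) FunField b) ^ 2) * Y_sq
  set n := a ^ 2 - b ^ 2 * rat h with hn
  -- compare norms to `ℚ(t)`
  have h1 : onC (rat (4 ^ (∑ i, r i) * M ^ 3)) = onC (rat (C (c ^ 2)) * n ^ 3) := by
    have h2 := congrArg conj hF
    rw [map_mul, algebraMap_funField, conj_onC, map_pow, map_prod] at h2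
    rw [algebraMap_funField] at hF
    have h3 := congrArg₂ (· * ·) hF h2
    simp only [← Finset.prod_mul_distrib, map_pow, ← mul_pow, intPolyg_mul_conj] at h3
    rw [onC_mul, onC_pow, ← hnorm, C_pow, rat_pow, onC_pow]
    have h4 : ofPoly (4 ^ (∑ i, r i) * M ^ 3) = ∏ i, ofPoly (4 * polyN i ^ 3) ^ r i := by
      simp only [hM, ← map_pow, ← map_prod, mul_pow, Finset.prod_mul_distrib,
        Finset.prod_pow_eq_pow_sum, ← Finset.prod_pow]
      congr 2
      exact Finset.prod_congr rfl fun i _ ↦ pow_right_comm _ _ _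
    rw [← ofPoly_apply, h4, h3]
    ring
  have h2 := onC_injective h1
  have hc : c ≠ 0 := by
    rintro rfl
    rw [zero_pow two_ne_zero, C_0, show rat 0 = 0 from map_zero _, zero_mul, rat_mul, rat_pow,
      rat_pow] at h2
    exact mul_ne_zero (pow_ne_zero _ ((map_ne_zero_iff _ (IsFractionRing.injective ℚ[X]
      (RatFunc ℚ))).2 (by norm_num))) (pow_ne_zero 3 hM0) h2
  have h3 : rat (C (c ^ 2)) * (n / rat M) ^ 3 = rat (C (4 ^ (∑ i, r i))) := by
    rw [div_pow, ← mul_div_assoc, ← h2, rat_mul, rat_pow M,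
      mul_div_cancel_right₀ _ (pow_ne_zero 3 hM0), C_pow, C_ofNat]
  obtain ⟨d, hd⟩ : ∃ d : ℚ, n / rat M = RatFunc.C d := by
    refine exists_eq_C_of_eval₂_eq_zero (p := C (c ^ 2) * X ^ 3 - C (4 ^ (∑ i, r i))) ?_ ?_
    · intro h0
      have := congrArg (fun p ↦ p.coeff 0) h0
      simp only [coeff_sub, coeff_C_mul, coeff_X_pow, coeff_C_zero, coeff_zero] at this
      norm_num at this
    · simp only [eval₂_sub, eval₂_mul, eval₂_C, eval₂_pow, eval₂_X]
      rw [sub_eq_zero]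
      exact h3
  have h4 : c ^ 2 * d ^ 3 = 4 ^ (∑ i, r i) := by
    rw [hd] at h3
    apply RatFunc.C_injective
    rw [map_mul, map_pow _ d]
    exact h3
  refine ⟨algebraMap ℚ FunField (c * d) * F, ?_⟩
  rw [map_prod]
  simp only [map_pow, map_mul, mul_pow, Finset.prod_mul_distrib, map_ofNat, hF,
    Finset.prod_pow_eq_pow_sum]
  have h5 := congrArg (algebraMap ℚ FunField) h4
  rw [map_mul, map_pow, map_pow, map_pow, map_ofNat] at h5
  rw [← h5]
  ring

/-- The `t`-coordinates of four points of the curve over the field of `19` elements. -/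
def pointT : Fin 4 → ℤ := ![9, 12, 3, 4]

/-- The `Y`-coordinates of the four points. -/
def pointY : Fin 4 → ℤ := ![8, 7, 1, 7]

/-- Cubic residue symbols: the sixth power of `4 * intPolyg i` at the `j`-th point is
`7 ^ residueExp j i`, where `7` is a cube root of unity modulo `19`. -/
def residueExp : Fin 4 → Fin 4 → ℕ :=
  ![![1, 1, 0, 2], ![2, 2, 0, 0], ![1, 2, 1, 2], ![2, 2, 1, 1]]

theorem eval₂_ofCoeffs {R : Type*} [CommRing R] (t : ℤ) (l : List ℤ) :
    eval₂ (Int.castRingHom R) (t : R) (ofCoeffs ℤ l) = (coeffEval t l : R) := by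
  rw [← eval_map, map_ofCoeffs, eval_ofCoeffs]

theorem pointY_sq (j : Fin 4) :
    (pointY j : ZMod 19) ^ 2 = eval₂ (Int.castRingHom (ZMod 19)) (pointT j : ZMod 19) intPolyh := by
  rw [intPolyh, eval₂_ofCoeffs]
  have h1 : ∀ j, ((19 : ℕ) : ℤ) ∣ pointY j ^ 2 - coeffEval (pointT j) coeffh := by decide +kernel
  have h2 := (ZMod.intCast_zmod_eq_zero_iff_dvd _ 19).2 (h1 j)
  push_cast at h2
  exact sub_eq_zero.1 h2

theorem evalAt_intPolyg_pow (i j : Fin 4) :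
    evalAt (pointT j : ZMod 19) (pointY j : ZMod 19) (4 * intPolyg i) ^ 6 =
      7 ^ residueExp j i := by
  have h1 : ∀ i j, ((19 : ℕ) : ℤ) ∣ (4 * (coeffEval (pointT j) (coeffV i) ^ 3 * pointY j +
      coeffEval (pointT j) (coeffU i))) ^ 6 - 7 ^ residueExp j i := by decide +kernel
  have h2 := (ZMod.intCast_zmod_eq_zero_iff_dvd _ 19).2 (h1 i j)
  push_cast at h2
  rw [← sub_eq_zero, ← h2]
  simp only [evalAt, intPolyg, map_mul, map_add, map_pow, map_ofNat, coe_eval₂RingHom, eval₂_C,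
    eval₂_X, eval₂_ofCoeffs]

/-- The four functions are independent modulo cubes and constants: otherwise the values at the
points modulo `19` of a product of them would be cubes. -/
theorem eq_zero_of_prod_eq_mul_cube {r : Fin 4 → ℕ} (hr : ∀ i, r i < 3) {c : ℚ} {F : FunField}
    (hF : ∏ i, evalY (intPolyg i) ^ r i = algebraMap ℚ FunField c * F ^ 3) (i : Fin 4) :
    r i = 0 := by
  have h7 : orderOf (7 : ZMod 19) = 3 := orderOf_eq_prime (by decide) (by decide)
  have h70 : (7 : ZMod 19) ≠ 0 := by decide
  have hy : ∀ j, 2 * (pointY j : ZMod 19) ^ 2 ≠ 0 := by decide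
  have : Fact (Nat.Prime 19) := ⟨by norm_num⟩
  obtain ⟨F', hF'⟩ := exists_eq_cube_of_eq_mul_cube hF
  have hsum : ∀ j, 3 ∣ ∑ i, residueExp j i * r i := by
    intro j
    obtain ⟨z, hz⟩ := exists_cube_eq_evalAt hF' (pointY_sq j)
    have h1 : evalAt (pointT j : ZMod 19) (pointY j : ZMod 19)
        (∏ i, (4 * intPolyg i) ^ r i) ^ 6 = 7 ^ ∑ i, residueExp j i * r i := by
      simp only [map_prod, map_pow, ← Finset.prod_pow, pow_right_comm _ _ 6, evalAt_intPolyg_pow,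
        ← pow_mul, Finset.prod_pow_eq_pow_sum]
    -- for a cube root `z` of the value, up to the cube `(2 y ^ 2) ^ 3`, both sixth powers are `1`
    have h2 : z ^ 18 = 7 ^ ∑ i, residueExp j i * r i := by
      calc z ^ 18 = (z ^ 3) ^ 6 := by ring
        _ = (2 * (pointY j : ZMod 19) ^ 2) ^ 18 * 7 ^ ∑ i, residueExp j i * r i := by
          rw [hz, mul_pow, h1]
          ring
        _ = _ := by rw [show 18 = 19 - 1 from rfl, ZMod.pow_card_sub_one_eq_one (hy j), one_mul]
    have hz0 : z ≠ 0 := by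
      rintro rfl
      rw [zero_pow (by norm_num)] at h2
      exact pow_ne_zero _ h70 h2.symm
    rw [show 18 = 19 - 1 from rfl, ZMod.pow_card_sub_one_eq_one hz0] at h2
    rw [← h7]
    exact orderOf_dvd_of_pow_eq_one h2.symm
  -- the matrix `residueExp` is invertible modulo `3`
  have h0 := hsum 0
  have h1 := hsum 1
  have h2 := hsum 2
  have h3 := hsum 3
  simp only [Fin.sum_univ_four, residueExp, Matrix.cons_val] at h0 h1 h2 h3
  have e0 := hr 0
  have e1 := hr 1
  have e2 := hr 2
  have e3 := hr 3
  fin_cases i <;> simp only [Fin.zero_eta, Fin.mk_one, Fin.reduceFinMk] <;> omega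

theorem three_dvd_of_prod_zpow_eq_mul_cube {e : Fin 4 → ℤ} {c : ℚ} {F : FunField}
    (hF : ∏ i, g i ^ e i = algebraMap ℚ FunField c * F ^ 3) (i : Fin 4) : 3 ∣ e i := by
  -- reduce the exponents modulo `3` at the cost of a cube
  have hr : ∀ i, ((e i % 3).toNat : ℤ) = e i + 3 * -(e i / 3) := by
    intro i
    omega
  have h1 : ∏ i, evalY (intPolyg i) ^ (e i % 3).toNat = algebraMap ℚ FunField c *
      (F * ∏ i, ofPoly (polyV i) ^ (e i % 3).toNat * g i ^ (-(e i / 3))) ^ 3 := by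
    rw [mul_pow, ← mul_assoc, ← hF, ← Finset.prod_pow, ← Finset.prod_mul_distrib]
    refine Finset.prod_congr rfl fun i _ ↦ ?_
    have h2 : g i ^ (e i % 3).toNat = g i ^ e i * (g i ^ (-(e i / 3))) ^ 3 := by
      rw [← zpow_natCast, hr, zpow_add₀ (g_ne_zero i), mul_comm 3, zpow_mul,
        ← zpow_natCast _ 3, Nat.cast_ofNat]
    rw [evalY_intPolyg, mul_pow, h2]
    ring
  have := eq_zero_of_prod_eq_mul_cube (fun i ↦ by omega) h1 i
  omega

/-! ### The classes in the Jacobian -/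

section Classes

variable {k K : Type*} [Field k] [Field K] [Algebra k K]

theorem IsDivisorOf.mul {f g : K} {D E : Divisor k K} (hf : IsDivisorOf f D)
    (hg : IsDivisorOf g E) : IsDivisorOf (f * g) (D + E) :=
  ⟨mul_ne_zero hf.1 hg.1, fun v ↦ by rw [Finsupp.add_apply, hf.2, hg.2, v.ord_mul hf.1 hg.1]⟩

theorem Place.ord_zpow (v : Place k K) (f : K) (n : ℤ) : v.ord (f ^ n) = n * v.ord f := by
  simp [Place.ord, WithZero.log_zpow]

theorem IsDivisorOf.zpow {f : K} {D : Divisor k K} (hf : IsDivisorOf f D) (n : ℤ) :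
    IsDivisorOf (f ^ n) (n • D) :=
  ⟨zpow_ne_zero n hf.1, fun v ↦ by
    rw [Finsupp.smul_apply, hf.2, v.ord_zpow, smul_eq_mul]⟩

theorem IsDivisorOf.prod {ι : Type*} (s : Finset ι) {f : ι → K} {D : ι → Divisor k K}
    (hf : ∀ i, IsDivisorOf (f i) (D i)) : IsDivisorOf (∏ i ∈ s, f i) (∑ i ∈ s, D i) := by
  classical
  induction s using Finset.induction_on with
  | empty => exact ⟨one_ne_zero, fun v ↦ v.ord_one.symm⟩
  | insert i s hi ih =>
    rw [Finset.prod_insert hi, Finset.sum_insert hi]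
    exact (hf i).mul ih

theorem Jac.mk_eq_zero_iff {D : Divisor.degreeZero k K} :
    (QuotientAddGroup.mk D : Jac k K) = 0 ↔ ∃ f : K, IsDivisorOf f (D : Divisor k K) := by
  rw [QuotientAddGroup.eq_zero_iff]
  exact Iff.rfl

end Classes

theorem three_dvd_of_sum_eq_zero {D : Fin 4 → Divisor.degreeZero ℚ FunField}
    (hD : ∀ i, IsDivisorOf (g i) (3 • (D i : Divisor ℚ FunField))) {e : Fin 4 → ℤ}
    (he : ∑ i, e i • (QuotientAddGroup.mk (D i) : Jac ℚ FunField) = 0) (i : Fin 4) :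
    3 ∣ e i := by
  have h1 : (QuotientAddGroup.mk (∑ i, e i • D i) : Jac ℚ FunField) = 0 := by
    rw [← he]
    exact map_sum (QuotientAddGroup.mk' _) _ _
  obtain ⟨F, hF⟩ := Jac.mk_eq_zero_iff.1 h1
  have h2 := IsDivisorOf.prod Finset.univ fun i ↦ (hD i).zpow (e i)
  have h3 : ((∑ i, e i • D i : Divisor.degreeZero ℚ FunField) : Divisor ℚ FunField) =
      ∑ i, e i • (D i : Divisor ℚ FunField) := by
    simp
  -- `∏ g i ^ e i` and `F ^ 3` have the same divisor
  obtain ⟨c, hc⟩ := exists_eq_algebraMap_of_ord_eq_zero odd_natDegree_h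
    (g := (∏ i, g i ^ e i) * (F ^ 3)⁻¹) (fun v ↦ by
      rw [v.ord_mul h2.1 (inv_ne_zero (pow_ne_zero 3 hF.1)), v.ord_inv (pow_ne_zero 3 hF.1),
        v.ord_pow, ← h2.2, ← hF.2, h3]
      simp only [Finsupp.coe_finsetSum, Finset.sum_apply, Finsupp.smul_apply, smul_eq_mul,
        nsmul_eq_mul, Finset.mul_sum]
      rw [← sub_eq_add_neg, ← Finset.sum_sub_distrib]
      exact Finset.sum_eq_zero fun i _ ↦ by ring)
  refine three_dvd_of_prod_zpow_eq_mul_cube (c := c) (F := F) ?_ i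
  rw [← hc, inv_mul_cancel_right₀ (pow_ne_zero 3 hF.1)]

theorem le_mRank {m r : ℕ} {M : Type*} [AddCommGroup M] (φ : (Fin r → ZMod m) →+ M)
    (hφ : Function.Injective φ) : (r : ℕ∞) ≤ mRank m M :=
  le_iSup₂ (f := fun (r : ℕ) (_ : r ∈ {r : ℕ | ∃ φ : (Fin r → ZMod m) →+ M,
    Function.Injective φ}) ↦ (r : ℕ∞)) r ⟨φ, hφ⟩

/-- Independent elements killed by `m` span a copy of `(ℤ/mℤ)^r` in the torsion subgroup. -/
theorem le_mRank_torsion {m r : ℕ} [NeZero m] {M : Type*} [AddCommGroup M] (x : Fin r → M)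
    (hx : ∀ i, m • x i = 0)
    (hind : ∀ e : Fin r → ℤ, ∑ i, e i • x i = 0 → ∀ i, (m : ℤ) ∣ e i) :
    (r : ℕ∞) ≤ mRank m (AddCommGroup.torsion M) := by
  have hx' : ∀ i, zmultiplesHom M (x i) (m : ℤ) = 0 := fun i ↦ by
    rw [zmultiplesHom_apply, natCast_zsmul, hx]
  let φ : (Fin r → ZMod m) →+ M := ∑ i,
    (ZMod.lift m ⟨zmultiplesHom M (x i), hx' i⟩).comp (Pi.evalAddMonoidHom (fun _ ↦ ZMod m) i)
  have hφ : ∀ a : Fin r → ZMod m, φ a = ∑ i, ((a i).val : ℤ) • x i := by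
    intro a
    simp only [φ, AddMonoidHom.finsetSum_apply, AddMonoidHom.comp_apply,
      Pi.evalAddMonoidHom_apply]
    refine Finset.sum_congr rfl fun i _ ↦ ?_
    have hi : (((a i).val : ℤ) : ZMod m) = a i := by
      rw [Int.cast_natCast, ZMod.natCast_zmod_val]
    exact (congrArg _ hi.symm).trans (ZMod.lift_coe m _ _)
  have hinj : Function.Injective φ := by
    rw [injective_iff_map_eq_zero]
    intro a ha
    rw [hφ] at ha
    funext i
    have := (ZMod.intCast_zmod_eq_zero_iff_dvd _ m).2 (hind _ ha i)
    rwa [Int.cast_natCast, ZMod.natCast_zmod_val] at this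
  refine le_mRank (φ.codRestrict (AddCommGroup.torsion M) fun a ↦ ?_) fun a b hab ↦
    hinj (congrArg Subtype.val hab)
  refine isOfFinAddOrder_iff_nsmul_eq_zero.2 ⟨m, Nat.pos_of_neZero m, ?_⟩
  rw [← map_nsmul]
  convert map_zero φ
  funext i
  simp

end CraigCurve

end

theorem mainTheorem9 :
    -- the parametric solution
    (CraigCurve.x₁ * CraigCurve.rat CraigCurve.z₁ = CraigCurve.rat (CraigCurve.x₀ * CraigCurve.z₀) ∧
      CraigCurve.x₂ * CraigCurve.y₂ = CraigCurve.x₀ * CraigCurve.y₀ ∧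
      CraigCurve.x₁ ^ 3 - CraigCurve.y₁ ^ 3 + CraigCurve.rat CraigCurve.z₁ ^ 3 =
        CraigCurve.rat (-(CraigCurve.x₀ ^ 3 - CraigCurve.y₀ ^ 3 + CraigCurve.z₀ ^ 3)) ∧
      CraigCurve.x₂ ^ 3 + CraigCurve.y₂ ^ 3 - CraigCurve.z₂ ^ 3 =
        -(CraigCurve.x₀ ^ 3 + CraigCurve.y₀ ^ 3 - CraigCurve.z₀ ^ 3)) ∧
    CraigCurve.h.natDegree = 141 ∧
    -- four independent classes of order three
    (∃ D : Fin 4 → CraigCurve.Divisor.degreeZero ℚ CraigCurve.FunField,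
      (∀ i, CraigCurve.IsDivisorOf (CraigCurve.g i)
        (3 • (D i : CraigCurve.Divisor ℚ CraigCurve.FunField))) ∧
      ∀ e : Fin 4 → ℤ,
        ∑ i, e i • (QuotientAddGroup.mk (D i) : CraigCurve.Jac ℚ CraigCurve.FunField) = 0 →
          ∀ i, (3 : ℤ) ∣ e i) ∧
    4 ≤ CraigCurve.mRank 3 (AddCommGroup.torsion (CraigCurve.Jac ℚ CraigCurve.FunField)) := by
  choose D hD using fun i ↦ CraigCurve.exists_degreeZero_of_three_dvd_ord
    CraigCurve.odd_natDegree_h (CraigCurve.g_ne_zero i) (CraigCurve.three_dvd_ord_g i)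
  refine ⟨⟨CraigCurve.x₁_mul_z₁, CraigCurve.x₂_mul_y₂, CraigCurve.x₁_cube_sub,
    CraigCurve.x₂_cube_add⟩, CraigCurve.natDegree_h,
    ⟨D, hD, fun e he ↦ CraigCurve.three_dvd_of_sum_eq_zero hD he⟩, ?_⟩
  refine CraigCurve.le_mRank_torsion (r := 4)
    (fun i ↦ (QuotientAddGroup.mk (D i) : CraigCurve.Jac ℚ CraigCurve.FunField)) (fun i ↦ ?_)
    fun e he ↦ CraigCurve.three_dvd_of_sum_eq_zero hD he
  exact CraigCurve.Jac.mk_eq_zero_iff.2 ⟨CraigCurve.g i, hD i⟩
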